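/- Let $n\ge 2$ and let $H_n=\mathbb R^{2n+1}$, with coordinates $(x,y,t)$, be the Heisenberg group, with contact form $\Theta=dt+\sum_{j=1}^n(x_j\,dy_j-y_j\,dx_j)$, contact planes $\xi=\ker\Theta$, frame $\mathring e_j=\partial_{x_j}+y_j\partial_t$, $\mathring e_{n+j}=\partial_{y_j}-x_j\partial_t$ ($1\le j\le n$) of $\xi$, $T=\partial_t$, CR structure $J\mathring e_j=\mathring e_{n+j}$, $J\mathring e_{n+j}=-\mathring e_j$, Levi metric $G=\sum_j(dx_j^2+dy_j^2)$ on $\xi$, and pseudohermitian connection $\nabla$, for which all $\mathring e_a$ and $T$ are parallel. Let $\Sigma$ be an immersed hypersurface of $H_n$ of class $C^2$. A point of $\Sigma$ is regular if $T\Sigma\ne\xi$ there; the regular part of $\Sigma$ is assumed to be $C^\infty$. At regular points put $\xi'=(\xi\cap T\Sigma)\cap J(\xi\cap T\Sigma)$. Locally on the regular part let $e_n$ be a continuous unit field in $\xi\cap T\Sigma$ orthogonal to $\xi'$ (it is unique up to sign), let $e_{2n}=Je_n$, and define the functions $\alpha$ and $l$ by $\alpha e_{2n}+T\in T\Sigma$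 and $-\nabla_{e_n}e_{2n}\equiv l\,e_n \pmod{\xi'}$. Let $J'$ be the endomorphism of $\xi\cap T\Sigma$ with $J'=J$ on $\xi'$ and $J'e_n=0$, let $\mathfrak S(v)=-\nabla_v e_{2n}+\alpha J'v$ for $v\in\xi\cap T\Sigma$, and let $\hat e_{2n}=(\alpha e_{2n}+T)/\sqrt{1+\alpha^2}\in T\Sigma$. A regular point is umbilic if $\mathfrak S(\xi')\subset\xi'$ and $\xi'$ has an orthonormal basis of eigenvectors of $\mathfrak S$ whose eigenvalues all coincide; the common eigenvalue is denoted by $k$. The hypersurface $\Sigma$ is umbilic if all its regular points are. **Proposition 4.2.** Let $\Sigma$ be an umbilic hypersurface of $H_n$, $n\ge2$. Then, for every local choice of $e_n$ as above, the functions $k$, $l$, $\alpha$ and $e_n\alpha$ are differentiable, and $$ek=el=e\alpha=e(e_n\alpha)=0\qquad\text{for all } e\in\xi',$$ $$e_nk=(l-2k)\alpha,\qquad \hat e_{2n}k=\frac{\alpha\,(k^2+e_n\alpha+\alpha^2)}{\sqrt{1+\alpha^2}},$$ $$e_n\alpha=k^2-\alpha^2-kl,\qquad \hat e_{2n}\alpha=\frac{-k\,(e_n\alpha)}{\sqrt{1+\alpha^2}},$$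 $$\hat e_{2n}l=\frac{e_ne_n\alpha+6\alpha\,e_n\alpha+4\alpha^3+\alpha l^2}{\sqrt{1+\alpha^2}}.$$ -/

import Mathlib

open scoped Manifold ContDiff

namespace HeisenbergUmbilic

/-- The horizontal space in the left-invariant frame: `a` stands for
`∑ j, (a (inl j)) e̊_j + (a (inr j)) e̊_{n+j}`.  Its Euclidean inner product is the Levi metric
`G = ∑ j, (dx_j)^2 + (dy_j)^2`, for which the frame `e̊` is orthonormal. -/
abbrev Hor (n : ℕ) : Type := EuclideanSpace ℝ (Fin n ⊕ Fin n)

/-- The underlying space `ℝ^{2n+1}` of the Heisenberg group `H_n`; the point `(z, t)` has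
coordinates `x_j = z (inl j)`, `y_j = z (inr j)` and `t`.  Tangent vectors of `H_n` at any point
are elements of the same vector space, in the coordinate frame `∂/∂x_j, ∂/∂y_j, ∂/∂t`. -/
abbrev Heis (n : ℕ) : Type := Hor n × ℝ

/-- The CR structure in the frame `e̊`: `J e̊_j = e̊_{n+j}`, `J e̊_{n+j} = - e̊_j`. -/
noncomputable def J (n : ℕ) : Hor n →ₗ[ℝ] Hor n where
  toFun a := WithLp.toLp 2 (Sum.elim (fun j => - a (Sum.inr j)) (fun j => a (Sum.inl j)))
  map_add' a b := by
    ext i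
    rcases i with j | j
    · simp [add_comm]
    · simp
  map_smul' c a := by
    ext i
    rcases i with j | j <;> simp

/-- The contact form `Θ = dt + ∑ j, (x_j dy_j - y_j dx_j)` at the point `q`. -/
noncomputable def Theta {n : ℕ} (q : Heis n) : Heis n →ₗ[ℝ] ℝ where
  toFun w := w.2 + ∑ j : Fin n, (q.1 (Sum.inl j) * w.1 (Sum.inr j)
    - q.1 (Sum.inr j) * w.1 (Sum.inl j))
  map_add' v w := by
    have h : ∀ j : Fin n, q.1 (Sum.inl j) * (v + w).1 (Sum.inr j)
        - q.1 (Sum.inr j) * (v + w).1 (Sum.inl j)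
        = (q.1 (Sum.inl j) * v.1 (Sum.inr j) - q.1 (Sum.inr j) * v.1 (Sum.inl j))
        + (q.1 (Sum.inl j) * w.1 (Sum.inr j) - q.1 (Sum.inr j) * w.1 (Sum.inl j)) := by
      intro j
      simp only [Prod.fst_add, PiLp.add_apply]
      ring
    simp only [h, Finset.sum_add_distrib, Prod.snd_add]
    ring
  map_smul' c v := by
    have h : ∀ j : Fin n, q.1 (Sum.inl j) * (c • v).1 (Sum.inr j)
        - q.1 (Sum.inr j) * (c • v).1 (Sum.inl j)
        = c * (q.1 (Sum.inl j) * v.1 (Sum.inr j) - q.1 (Sum.inr j) * v.1 (Sum.inl j)) := by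
      intro j
      simp only [Prod.smul_fst, PiLp.smul_apply, smul_eq_mul]
      ring
    simp only [h, ← Finset.mul_sum, Prod.smul_snd, smul_eq_mul, RingHom.id_apply]
    ring

/-- The contact plane `ξ = ker Θ` at the point `q`. -/
noncomputable def contactPlane {n : ℕ} (q : Heis n) : Submodule ℝ (Heis n) :=
  LinearMap.ker (Theta q)

/-- The horizontal vector at `q` with components `a` in the left-invariant frame
`e̊_j = ∂/∂x_j + y_j ∂/∂t`, `e̊_{n+j} = ∂/∂y_j - x_j ∂/∂t`. -/
noncomputable def hor {n : ℕ} (q : Heis n) : Hor n →ₗ[ℝ] Heis n where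
  toFun a := (a, ∑ j : Fin n, (q.1 (Sum.inr j) * a (Sum.inl j)
    - q.1 (Sum.inl j) * a (Sum.inr j)))
  map_add' a b := by
    refine Prod.ext rfl ?_
    simp only [PiLp.add_apply, Prod.snd_add, ← Finset.sum_add_distrib]
    exact Finset.sum_congr rfl fun j _ => by ring
  map_smul' c a := by
    refine Prod.ext rfl ?_
    simp only [PiLp.smul_apply, smul_eq_mul, Prod.smul_snd, RingHom.id_apply, Finset.mul_sum]
    exact Finset.sum_congr rfl fun j _ => by ring

/-- The frame `e̊` spans the contact plane. -/
theorem range_hor {n : ℕ} (q : Heis n) : LinearMap.range (hor q) = contactPlane q := by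
  ext w
  constructor
  · rintro ⟨a, rfl⟩
    change (∑ j : Fin n, (q.1 (Sum.inr j) * a (Sum.inl j) - q.1 (Sum.inl j) * a (Sum.inr j)))
      + ∑ j : Fin n, (q.1 (Sum.inl j) * a (Sum.inr j) - q.1 (Sum.inr j) * a (Sum.inl j)) = 0
    rw [← Finset.sum_add_distrib]
    exact Finset.sum_eq_zero fun j _ => by ring
  · intro hw
    have hw' : w.2 + ∑ j : Fin n, (q.1 (Sum.inl j) * w.1 (Sum.inr j)
      - q.1 (Sum.inr j) * w.1 (Sum.inl j)) = 0 := hw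
    refine ⟨w.1, Prod.ext rfl ?_⟩
    change (∑ j : Fin n, (q.1 (Sum.inr j) * w.1 (Sum.inl j) - q.1 (Sum.inl j) * w.1 (Sum.inr j)))
      = w.2
    rw [eq_neg_of_add_eq_zero_left hw', ← Finset.sum_neg_distrib]
    exact Finset.sum_congr rfl fun j _ => by ring

/-- The Reeb vector field `T = ∂/∂t`. -/
def T (n : ℕ) : Heis n := (0, 1)

section Hypersurface

variable {n : ℕ} {M : Type*} [TopologicalSpace M]
  [ChartedSpace (EuclideanSpace ℝ (Fin (2 * n))) M]

/-- The differential of `φ : M → H_n` at `p`. -/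
noncomputable def diff (φ : M → Heis n) (p : M) :
    TangentSpace (𝓡 (2 * n)) p →L[ℝ] Heis n :=
  mfderiv (𝓡 (2 * n)) 𝓘(ℝ, Heis n) φ p

/-- The tangent space `TΣ` of the immersed hypersurface `Σ = φ(M)` at (the sheet through) `p`. -/
noncomputable def tangent (φ : M → Heis n) (p : M) : Submodule ℝ (Heis n) :=
  LinearMap.range (diff φ p).toLinearMap

/-- `p` is regular (nonsingular) if `TΣ ≠ ξ` at `p`. -/
def IsRegular (φ : M → Heis n) (p : M) : Prop :=
  tangent φ p ≠ contactPlane (φ p)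

/-- `φ : M → H_n` is an immersed hypersurface of class `C^2` whose regular part is `C^∞`: around
every regular point there are `C^2`-compatible coordinates of `M` in which `φ` is `C^∞`. -/
structure IsHypersurface (φ : M → Heis n) : Prop where
  contMDiff : ContMDiff (𝓡 (2 * n)) 𝓘(ℝ, Heis n) 2 φ
  immersion : ∀ p, Function.Injective (diff φ p)
  smooth_regular : ∀ p, IsRegular φ p →
    ∃ e ∈ IsManifold.maximalAtlas (𝓡 (2 * n)) 2 M,
      p ∈ e.source ∧ ContDiffOn ℝ ∞ (φ ∘ e.symm) e.target

/-- The derivative at `p` of a function `f` on `Σ` along the vector `w ∈ TΣ`: it is `df(v)`, where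
`v` is the tangent vector of `M` at `p` with `dφ(v) = w` (unique, as `φ` is an immersion). -/
noncomputable def dirDeriv {F : Type*} [NormedAddCommGroup F] [NormedSpace ℝ F]
    (φ : M → Heis n) (f : M → F) (p : M) (w : Heis n) : F :=
  haveI : Nonempty (TangentSpace (𝓡 (2 * n)) p) := ⟨0⟩
  (mfderiv (𝓡 (2 * n)) 𝓘(ℝ, F) f p : TangentSpace (𝓡 (2 * n)) p →L[ℝ] F)
    (Function.invFun (diff φ p) w)

/-- The pseudohermitian connection of `H_n` along `Σ`: since the frame `e̊` is parallel,
`∇_a X = ∑ (a X^i) e̊_i` for a horizontal field `X = ∑ X^i e̊_i` along `Σ` and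
`a ∈ ξ ∩ TΣ`. -/
noncomputable def nabla (φ : M → Heis n) (X : M → Hor n) (p : M) (a : Hor n) : Hor n :=
  dirDeriv φ X p (hor (φ p) a)

/-- `ξ ∩ TΣ` at `p`, in the frame `e̊`. -/
noncomputable def horTangent (φ : M → Heis n) (p : M) : Submodule ℝ (Hor n) :=
  (tangent φ p).comap (hor (φ p))

/-- `ξ' = (ξ ∩ TΣ) ∩ J (ξ ∩ TΣ)` at `p`, in the frame `e̊`. -/
noncomputable def xiPrime (φ : M → Heis n) (p : M) : Submodule ℝ (Hor n) :=
  horTangent φ p ⊓ (horTangent φ p).map (J n)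

/-- On the open set `W` of regular points, `en` is a continuous choice of the unit field
`e_n ∈ (ξ ∩ TΣ) ∩ (ξ')^⊥`, and `α` is the function with `α e_{2n} + T ∈ TΣ`, where
`e_{2n} = J e_n`. -/
structure IsAdapted (φ : M → Heis n) (W : Set M) (en : M → Hor n) (α : M → ℝ) : Prop where
  isOpen : IsOpen W
  regular : ∀ p ∈ W, IsRegular φ p
  continuousOn : ContinuousOn en W
  norm_eq_one : ∀ p ∈ W, ‖en p‖ = 1
  mem_horTangent : ∀ p ∈ W, en p ∈ horTangent φ p
  mem_orthogonal : ∀ p ∈ W, en p ∈ (xiPrime φ p)ᗮ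
  alpha_spec : ∀ p ∈ W, α p • hor (φ p) (J n (en p)) + T n ∈ tangent φ p

/-- The endomorphism `J'` of `ξ ∩ TΣ = ξ' ⊕ ℝ e_n` with `J' = J` on `ξ'` and `J' e_n = 0`; here
`u` is the value of `e_n`. -/
noncomputable def Jprime (u a : Hor n) : Hor n :=
  J n (a - inner ℝ u a • u)

/-- The shape operator `𝔖(a) = -∇_a e_{2n} + α J' a` on `ξ ∩ TΣ` at `p`. -/
noncomputable def shape (φ : M → Heis n) (en : M → Hor n) (α : M → ℝ) (p : M) (a : Hor n) :
    Hor n :=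
  - nabla φ (fun q => J n (en q)) p a + α p • Jprime (en p) a

/-- `p` is an umbilic point: it is regular, and for every local choice of `e_n` around `p`
(there are two, differing by a sign) `𝔖` maps `ξ'` to itself and has on `ξ'` an orthonormal
eigenbasis whose eigenvalues all coincide. -/
def IsUmbilicAt (φ : M → Heis n) (p : M) : Prop :=
  IsRegular φ p ∧
  ∀ (W : Set M) (en : M → Hor n) (α : M → ℝ), IsAdapted φ W en α → p ∈ W →
    (∀ a ∈ xiPrime φ p, shape φ en α p a ∈ xiPrime φ p) ∧
    ∃ (e : Fin (2 * (n - 1)) → Hor n) (lam : Fin (2 * (n - 1)) → ℝ),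
      Orthonormal ℝ e ∧ Submodule.span ℝ (Set.range e) = xiPrime φ p ∧
      (∀ j, shape φ en α p (e j) = lam j • e j) ∧ ∀ i j, lam i = lam j

/-- An umbilic hypersurface: all regular points are umbilic. -/
def IsUmbilic (φ : M → Heis n) : Prop :=
  ∀ p, IsRegular φ p → IsUmbilicAt φ p

/-- `c` is an eigenvalue of `𝔖` on `ξ'` at `p`. -/
def IsEigenvalueAt (φ : M → Heis n) (en : M → Hor n) (α : M → ℝ) (p : M) (c : ℝ) : Prop :=
  ∃ a ∈ xiPrime φ p, a ≠ 0 ∧ shape φ en α p a = c • a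

/-- The derivative `e_n f`. -/
noncomputable def derivEn (φ : M → Heis n) (en : M → Hor n) (f : M → ℝ) (p : M) : ℝ :=
  dirDeriv φ f p (hor (φ p) (en p))

/-- The unit vector `ê_{2n} = (α e_{2n} + T) / √(1 + α²) ∈ TΣ`. -/
noncomputable def hatE (φ : M → Heis n) (en : M → Hor n) (α : M → ℝ) (p : M) : Heis n :=
  (Real.sqrt (1 + α p ^ 2))⁻¹ • (α p • hor (φ p) (J n (en p)) + T n)

end Hypersurface

end HeisenbergUmbilic

/-! Since the frame `e̊` is parallel, the statement is Euclidean calculus. In a chart, Σ is a map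
`(Z, τ)` into `V × ℝ`, the field e_{2n} is a unit-vector-valued map `ν` with e_n = -Jν, and, with θ
the pullback of the contact form, tangency reads ⟨ν, dZ⟩ = α θ. The exterior derivative of this
relation (`structure_equation`) and umbilicity determine `dν` up to the coefficient C of θ
(`fderiv_normal`, `contactCoeff`). Together with |ν| = 1 it also gives the components of C: kα along
ν, e_nα + α² along Jν, and minus the derivative of α along ξ'.

Everything else is d(dν) = 0 (`integrability`), evaluated on pairs of tangent vectors and paired
with a test vector. Let v be in ξ' and let E = αν + T, a multiple of ê_{2n}. The pair (v, Jv) gives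
the formula for e_nα and vk = -3 (Jv)α; the pair (v, e_n) gives vl = 0 and the formula for e_nk. The
pair (v, E) gives v(e_nα), which can also be found by differentiating the formula for e_nα;
comparing the two leaves (2k - l) vα = 0 (`two_mul_k_sub_l_mul`). If vα ≠ 0 at a point, then l = 2k
near it, so k is constant along ξ' because l is, and then so is α: a contradiction
(`fderiv_alpha_complex`). Hence C lies in the span of ν and Jν, and the pairs (v, E) and (e_n, E)
yield the derivatives of k, α and l along E.

Regularity has to be earned: e_n is only continuous, and α, k, l are given pointwise. Smoothness of
ν and α comes from inverting the differential of Σ completed by a transverse vector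
(`contDiffAt_normal_and_alpha`); k and l are then read off from `dν`. -/

namespace HeisenbergUmbilic

/-! ### Parametrized patches; smoothness of the normal and of α -/

section Patch

variable {E V : Type*} [NormedAddCommGroup E] [NormedSpace ℝ E]
  [NormedAddCommGroup V] [InnerProductSpace ℝ V]

/-- An orthogonal complex structure on a Euclidean space. -/
structure IsComplexStructure (J : V →L[ℝ] V) : Prop where
  sq : ∀ a, J (J a) = -a
  inner_map : ∀ a b, inner ℝ (J a) (J b) = inner ℝ a b

/-- The pullback of the contact form `dτ + ⟨J Z, dZ⟩` by the map `(Z, τ)`. -/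
noncomputable def contactPullback (J : V →L[ℝ] V) (Z : E → V) (τ : E → ℝ) (x : E) : E →L[ℝ] ℝ :=
  fderiv ℝ τ x + (innerSL ℝ (J (Z x))).comp (fderiv ℝ Z x)

/-- A parametrized umbilic hypersurface `(Z, τ) : U → V × ℝ`.  The horizontal normal is `ν`, and
`-J ν` is the distinguished horizontal tangent direction. -/
structure UmbilicPatch (J : V →L[ℝ] V) (U : Set E) (Z : E → V) (τ : E → ℝ) (ν : E → V)
    (α k l : E → ℝ) : Prop where
  isOpen : IsOpen U
  smooth_fst : ∀ x ∈ U, ContDiffAt ℝ ∞ Z x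
  smooth_snd : ∀ x ∈ U, ContDiffAt ℝ ∞ τ x
  continuousAt : ∀ x ∈ U, ContinuousAt ν x
  norm_eq_one : ∀ x ∈ U, ‖ν x‖ = 1
  conormal : ∀ x ∈ U, ∀ v, inner ℝ (ν x) (fderiv ℝ Z x v) = α x * contactPullback J Z τ x v
  injective : ∀ x ∈ U, ∀ v, fderiv ℝ Z x v = 0 → contactPullback J Z τ x v = 0 → v = 0
  surjective : ∀ x ∈ U, ∀ (a : V) (s : ℝ), inner ℝ (ν x) a = α x * s →
    ∃ v, fderiv ℝ Z x v = a ∧ contactPullback J Z τ x v = s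
  umbilic : ∀ x ∈ U, ∀ v, contactPullback J Z τ x v = 0 →
    inner ℝ (-J (ν x)) (fderiv ℝ Z x v) = 0 →
    fderiv ℝ ν x v = α x • J (fderiv ℝ Z x v) - k x • fderiv ℝ Z x v
  principal : ∀ x ∈ U, ∀ v, contactPullback J Z τ x v = 0 → fderiv ℝ Z x v = -J (ν x) →
    inner ℝ (-J (ν x)) (fderiv ℝ ν x v) = -l x
  exists_ne : ∀ x ∈ U, ∃ a, a ≠ 0 ∧ inner ℝ (ν x) a = 0 ∧ inner ℝ (-J (ν x)) a = 0

/-- The differential of `(Z, τ)`, in the frame of the contact planes, extended to `E × ℝ` by the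
horizontal direction `m`. -/
noncomputable def augmented (J : V →L[ℝ] V) (Z : E → V) (τ : E → ℝ) (m : V) (x : E) :
    E × ℝ →L[ℝ] V × ℝ :=
  (ContinuousLinearMap.inl ℝ V ℝ).comp ((fderiv ℝ Z x).comp (ContinuousLinearMap.fst ℝ E ℝ)
    + (ContinuousLinearMap.toSpanSingleton ℝ m).comp (ContinuousLinearMap.snd ℝ E ℝ))
  + (ContinuousLinearMap.inr ℝ V ℝ).comp
    ((contactPullback J Z τ x).comp (ContinuousLinearMap.fst ℝ E ℝ))

theorem augmented_apply (J : V →L[ℝ] V) (Z : E → V) (τ : E → ℝ) (m : V) (x : E) (w : E × ℝ) :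
    augmented J Z τ m x w = (fderiv ℝ Z x w.1 + w.2 • m, contactPullback J Z τ x w.1) := by
  simp [augmented]

theorem contDiffAt_contactPullback {J : V →L[ℝ] V} {Z : E → V} {τ : E → ℝ} {x : E}
    (hZ : ContDiffAt ℝ ∞ Z x) (hτ : ContDiffAt ℝ ∞ τ x) :
    ContDiffAt ℝ ∞ (contactPullback J Z τ) x := by
  have h1 : ContDiffAt ℝ ∞ (fderiv ℝ τ) x := hτ.fderiv_right (by simp)
  have h2 : ContDiffAt ℝ ∞ (fderiv ℝ Z) x := hZ.fderiv_right (by simp)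
  have h3 : ContDiffAt ℝ ∞ (fun y => innerSL ℝ (J (Z y))) x :=
    (innerSL ℝ).contDiff.contDiffAt.comp x (J.contDiff.contDiffAt.comp x hZ)
  exact h1.add (h3.clm_comp h2)

theorem contDiffAt_augmented {J : V →L[ℝ] V} {Z : E → V} {τ : E → ℝ} {x : E} (m : V)
    (hZ : ContDiffAt ℝ ∞ Z x) (hτ : ContDiffAt ℝ ∞ τ x) :
    ContDiffAt ℝ ∞ (augmented J Z τ m) x := by
  have h2 : ContDiffAt ℝ ∞ (fderiv ℝ Z) x := hZ.fderiv_right (by simp)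
  have h1 := contDiffAt_contactPullback (J := J) hZ hτ
  exact (contDiffAt_const.clm_comp ((h2.clm_comp contDiffAt_const).add contDiffAt_const)).add
    (contDiffAt_const.clm_comp (h1.clm_comp contDiffAt_const))

variable {J : V →L[ℝ] V} {U : Set E} {Z : E → V} {τ : E → ℝ} {ν : E → V} {α k l : E → ℝ}

namespace UmbilicPatch

variable (P : UmbilicPatch J U Z τ ν α k l)
include P

theorem inner_self {x : E} (hx : x ∈ U) : inner ℝ (ν x) (ν x) = (1 : ℝ) := by
  rw [real_inner_self_eq_norm_sq, P.norm_eq_one x hx, one_pow]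

/-- By the conormal relation, no horizontal vector `m` with ⟨ν, m⟩ ≠ 0 is tangent, so adding it as
an extra column completes the differential to an isomorphism. Its inverse then depends smoothly on
the point, although `ν` is not yet known to be smooth. -/
theorem augmented_injective {x : E} (hx : x ∈ U) {m : V} (hm : inner ℝ (ν x) m ≠ (0 : ℝ)) :
    Function.Injective (augmented J Z τ m x) := by
  rw [injective_iff_map_eq_zero]
  rintro ⟨v, r⟩ h
  rw [augmented_apply, Prod.mk_eq_zero] at h
  have h1 := P.conormal x hx v
  rw [h.2, eq_neg_of_add_eq_zero_left h.1, inner_neg_right, inner_smul_right, mul_zero,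
    neg_eq_zero, mul_eq_zero] at h1
  have hr : r = 0 := h1.resolve_right hm
  have hv := P.injective x hx v (by simpa [hr] using h.1) h.2
  rw [hr, hv]; rfl

theorem augmented_surjective {x : E} (hx : x ∈ U) {m : V} (hm : inner ℝ (ν x) m ≠ (0 : ℝ)) :
    Function.Surjective (augmented J Z τ m x) := by
  rintro ⟨a, s⟩
  obtain ⟨v, h1, h2⟩ := P.surjective x hx
    (a - ((inner ℝ (ν x) a - α x * s) / inner ℝ (ν x) m) • m) s (by
      rw [inner_sub_right, inner_smul_right]; field_simp; ring)
  refine ⟨(v, (inner ℝ (ν x) a - α x * s) / inner ℝ (ν x) m), ?_⟩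
  rw [augmented_apply, h1, h2, sub_add_cancel]

theorem eventually_inner_pos {x : E} (hx : x ∈ U) :
    ∀ᶠ y in nhds x, y ∈ U ∧ 0 < inner ℝ (ν y) (ν x) := by
  have h1 : ContinuousAt (fun y => inner ℝ (ν y) (ν x)) x :=
    (P.continuousAt x hx).inner continuousAt_const
  have h2 : (0 : ℝ) < inner ℝ (ν x) (ν x) := by rw [P.inner_self hx]; exact one_pos
  exact Filter.Eventually.and (P.isOpen.mem_nhds hx) (h1.eventually_const_lt h2)

variable [CompleteSpace E] [FiniteDimensional ℝ V]

theorem exists_equiv {x : E} (hx : x ∈ U) {m : V} (hm : inner ℝ (ν x) m ≠ (0 : ℝ)) :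
    ∃ A : (E × ℝ) ≃L[ℝ] V × ℝ, (A : E × ℝ →L[ℝ] V × ℝ) = augmented J Z τ m x :=
  ⟨ContinuousLinearEquiv.ofBijective (augmented J Z τ m x)
    (LinearMap.ker_eq_bot.2 (P.augmented_injective hx hm))
    (LinearMap.range_eq_top.2 (P.augmented_surjective hx hm)), by ext <;> rfl⟩

theorem contDiffAt_inverse {x : E} (hx : x ∈ U) {m : V} (hm : inner ℝ (ν x) m ≠ (0 : ℝ)) :
    ContDiffAt ℝ ∞ (fun y => (augmented J Z τ m y).inverse) x := by
  obtain ⟨A, hA⟩ := P.exists_equiv hx hm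
  have h := contDiffAt_map_inverse (n := ∞) A
  rw [hA] at h
  exact h.comp x (contDiffAt_augmented m (P.smooth_fst x hx) (P.smooth_snd x hx))

theorem inverse_apply {x : E} (hx : x ∈ U) {m : V} (hm : inner ℝ (ν x) m ≠ (0 : ℝ)) (w : E × ℝ) :
    (augmented J Z τ m x).inverse (augmented J Z τ m x w) = w := by
  obtain ⟨A, hA⟩ := P.exists_equiv hx hm
  rw [← hA]; simp

/-- The extra coordinate of the inverse is a conormal. -/
theorem inverse_snd {x : E} (hx : x ∈ U) {m : V} (hm : inner ℝ (ν x) m ≠ (0 : ℝ)) (w : V × ℝ) :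
    inner ℝ (ν x) m * ((augmented J Z τ m x).inverse w).2 = inner ℝ (ν x) w.1 - α x * w.2 := by
  obtain ⟨⟨v, r⟩, rfl⟩ := P.augmented_surjective hx hm w
  rw [P.inverse_apply hx hm, augmented_apply]
  simp only [inner_add_right, inner_smul_right, P.conormal x hx v]
  ring

theorem inverse_fst {x : E} (hx : x ∈ U) {m : V} (hm : inner ℝ (ν x) m ≠ (0 : ℝ)) {v : E} {a : V}
    {s : ℝ} (ha : fderiv ℝ Z x v = a) (hs : contactPullback J Z τ x v = s) :
    ((augmented J Z τ m x).inverse (a, s)).1 = v := by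
  have h := P.inverse_apply hx hm (v, 0)
  rw [augmented_apply] at h
  simp only [zero_smul, add_zero, ha, hs] at h
  rw [h]

/-- The transverse vector is frozen at `ν x`. The last coordinate of the inverse is then a smooth
conormal, equal to (ν, -α) divided by ⟨ν y, ν x⟩. Normalizing its horizontal part recovers `ν`;
continuity of `ν` keeps that scalar product positive near `x`, which settles the sign. -/
theorem contDiffAt_normal_and_alpha {x : E} (hx : x ∈ U) :
    ContDiffAt ℝ ∞ ν x ∧ ContDiffAt ℝ ∞ α x := by
  have hm : inner ℝ (ν x) (ν x) ≠ (0 : ℝ) := by rw [P.inner_self hx]; exact one_ne_zero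
  set R : E → V × ℝ →L[ℝ] E × ℝ := fun y => (augmented J Z τ (ν x) y).inverse with hR
  have hRs : ContDiffAt ℝ ∞ R x := P.contDiffAt_inverse hx hm
  have hRw : ∀ w, ContDiffAt ℝ ∞ (fun y => (R y w).2) x := fun w =>
    (hRs.clm_apply contDiffAt_const).snd
  let b := stdOrthonormalBasis ℝ V
  set N : E → V := fun y => ∑ i, (R y (b i, 0)).2 • b i with hN
  have hNs : ContDiffAt ℝ ∞ N x := ContDiffAt.sum fun i _ => (hRw _).smul contDiffAt_const
  have hNν : ∀ y ∈ U, 0 < inner ℝ (ν y) (ν x) → ν y = (inner ℝ (ν y) (ν x) : ℝ) • N y := by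
    intro y hy hpos
    rw [hN, Finset.smul_sum]
    conv_lhs => rw [← b.sum_repr' (ν y)]
    refine Finset.sum_congr rfl fun i _ => ?_
    rw [smul_smul, P.inverse_snd hy hpos.ne', mul_zero, sub_zero, real_inner_comm]
  have hnorm : ∀ y ∈ U, 0 < inner ℝ (ν y) (ν x) → (inner ℝ (ν y) (ν x) : ℝ) = ‖N y‖⁻¹ := by
    intro y hy hpos
    have h1 := congrArg norm (hNν y hy hpos)
    rw [norm_smul, P.norm_eq_one y hy, Real.norm_of_nonneg hpos.le] at h1
    exact eq_inv_of_mul_eq_one_left h1.symm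
  have hNx : N x ≠ 0 := by
    intro h0
    have h1 := hnorm x hx (by rw [P.inner_self hx]; exact one_pos)
    rw [P.inner_self hx, h0, norm_zero, inv_zero] at h1
    exact one_ne_zero h1
  have hinv : ContDiffAt ℝ ∞ (fun y => ‖N y‖⁻¹) x :=
    (hNs.norm ℝ hNx).inv (norm_ne_zero_iff.2 hNx)
  constructor
  · refine (hinv.smul hNs).congr_of_eventuallyEq ?_
    filter_upwards [P.eventually_inner_pos hx] with y hy
    rw [Pi.smul_apply', ← hnorm y hy.1 hy.2]
    exact hNν y hy.1 hy.2
  -- At (0, 1) the conormal takes the value -α / ⟨ν y, ν x⟩.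
  · refine (hinv.mul (hRw (0, 1))).neg.congr_of_eventuallyEq ?_
    filter_upwards [P.eventually_inner_pos hx] with y hy
    rw [← hnorm y hy.1 hy.2, P.inverse_snd hy.1 hy.2.ne']
    simp

end UmbilicPatch

end Patch

end HeisenbergUmbilic

namespace HeisenbergUmbilic

/-! ### The exterior derivative of the conormal relation and the full formula for dν -/

section Patch

variable {E V : Type*} [NormedAddCommGroup E] [NormedSpace ℝ E]
  [NormedAddCommGroup V] [InnerProductSpace ℝ V]

namespace IsComplexStructure

variable {J : V →L[ℝ] V} (hJ : IsComplexStructure J)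
include hJ

theorem inner_left (a b : V) : inner ℝ (J a) b = -(inner ℝ a (J b) : ℝ) := by
  rw [← hJ.inner_map (J a) b, hJ.sq, inner_neg_left]

theorem inner_self_left (a : V) : inner ℝ (J a) a = (0 : ℝ) := by
  have h := hJ.inner_left a a
  rw [real_inner_comm (J a) a] at h
  linarith

theorem inner_self_right (a : V) : inner ℝ a (J a) = (0 : ℝ) := by
  rw [real_inner_comm, hJ.inner_self_left]

theorem inner_neg_self (a : V) : inner ℝ a (-J a) = (0 : ℝ) := by
  rw [inner_neg_right, hJ.inner_self_right, neg_zero]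

end IsComplexStructure

theorem hasDerivAt_line {F : Type*} [NormedAddCommGroup F] [NormedSpace ℝ F] {f : E → F} {x : E}
    (hf : DifferentiableAt ℝ f x) (v : E) :
    HasDerivAt (fun t : ℝ => f (x + t • v)) (fderiv ℝ f x v) 0 :=
  hf.hasFDerivAt.hasLineDerivAt v

theorem hasDerivAt_fderiv_line {F : Type*} [NormedAddCommGroup F] [NormedSpace ℝ F] {f : E → F}
    {x : E} (hf : ContDiffAt ℝ ∞ f x) (v w : E) :
    HasDerivAt (fun t : ℝ => fderiv ℝ f (x + t • v) w) (fderiv ℝ (fderiv ℝ f) x v w) 0 := by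
  have h : ContDiffAt ℝ ∞ (fderiv ℝ f) x := hf.fderiv_right (by simp)
  simpa using (hasDerivAt_line (h.differentiableAt (by simp)) v).clm_apply (hasDerivAt_const 0 w)

theorem fderiv_fderiv_comm {F : Type*} [NormedAddCommGroup F] [NormedSpace ℝ F] {f : E → F}
    {x : E} (hf : ContDiffAt ℝ ∞ f x) (v w : E) :
    fderiv ℝ (fderiv ℝ f) x v w = fderiv ℝ (fderiv ℝ f) x w v :=
  hf.isSymmSndFDerivAt (by rw [minSmoothness_of_isRCLikeNormedField]; exact WithTop.coe_le_coe.2 le_top) v w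

theorem eventually_line_mem {U : Set E} (hU : IsOpen U) {x : E} (hx : x ∈ U) (v : E) :
    ∀ᶠ t : ℝ in nhds 0, x + t • v ∈ U := by
  have h : ContinuousAt (fun t : ℝ => x + t • v) 0 := by fun_prop
  exact h.eventually (by simpa using hU.mem_nhds hx)

/-- The tangent vector with given horizontal part and given value of the contact form. -/
noncomputable def tangentLift (J : V →L[ℝ] V) (Z : E → V) (τ : E → ℝ) (x : E) (w : V × ℝ) : E :=
  Function.invFun (fun v => (fderiv ℝ Z x v, contactPullback J Z τ x v)) w

variable {J : V →L[ℝ] V} {U : Set E} {Z : E → V} {τ : E → ℝ} {ν : E → V} {α k l : E → ℝ}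

theorem hasDerivAt_contactPullback_line {x : E} (hZ : ContDiffAt ℝ ∞ Z x)
    (hτ : ContDiffAt ℝ ∞ τ x) (v w : E) :
    HasDerivAt (fun t : ℝ => contactPullback J Z τ (x + t • v) w)
      (fderiv ℝ (fderiv ℝ τ) x v w + (inner ℝ (J (Z x)) (fderiv ℝ (fderiv ℝ Z) x v w)
        + inner ℝ (J (fderiv ℝ Z x v)) (fderiv ℝ Z x w))) 0 := by
  have h1 := J.hasFDerivAt.comp_hasDerivAt (0 : ℝ)
    (hasDerivAt_line (hZ.differentiableAt (by simp)) v)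
  have h := (hasDerivAt_fderiv_line hτ v w).add (h1.inner ℝ (hasDerivAt_fderiv_line hZ v w))
  simp only [Function.comp_def, zero_smul, add_zero] at h
  exact h

namespace UmbilicPatch

variable (P : UmbilicPatch J U Z τ ν α k l)
include P

theorem tangentLift_spec {x : E} (hx : x ∈ U) {w : V × ℝ}
    (hw : inner ℝ (ν x) w.1 = α x * w.2) :
    fderiv ℝ Z x (tangentLift J Z τ x w) = w.1 ∧
      contactPullback J Z τ x (tangentLift J Z τ x w) = w.2 := by
  obtain ⟨v, h1, h2⟩ := P.surjective x hx w.1 w.2 hw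
  have h := Function.invFun_eq (f := fun v => (fderiv ℝ Z x v, contactPullback J Z τ x v))
    (b := w) ⟨v, Prod.ext h1 h2⟩
  exact ⟨congrArg Prod.fst h, congrArg Prod.snd h⟩

theorem eq_of_eq {x : E} (hx : x ∈ U) {v w : E} (h1 : fderiv ℝ Z x v = fderiv ℝ Z x w)
    (h2 : contactPullback J Z τ x v = contactPullback J Z τ x w) : v = w :=
  sub_eq_zero.1 (P.injective x hx _ (by rw [map_sub, h1, sub_self]) (by rw [map_sub, h2, sub_self]))

variable [CompleteSpace E] [FiniteDimensional ℝ V]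

/-- Near `x` the lift is the first component of the smooth inverse of the augmented differential, so
the choice made by `Function.invFun` is harmless. -/
theorem contDiffAt_tangentLift {x : E} (hx : x ∈ U) {w : E → V × ℝ} (hws : ContDiffAt ℝ ∞ w x)
    (hw : ∀ y ∈ U, inner ℝ (ν y) (w y).1 = α y * (w y).2) :
    ContDiffAt ℝ ∞ (fun y => tangentLift J Z τ y (w y)) x := by
  have hm : inner ℝ (ν x) (ν x) ≠ (0 : ℝ) := by rw [P.inner_self hx]; exact one_ne_zero
  refine ((P.contDiffAt_inverse hx hm).clm_apply hws).fst.congr_of_eventuallyEq ?_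
  filter_upwards [P.eventually_inner_pos hx] with y hy
  have h := P.tangentLift_spec hy.1 (hw y hy.1)
  exact (P.inverse_fst hy.1 hy.2.ne' h.1 h.2).symm

theorem differentiableAt_normal {x : E} (hx : x ∈ U) : DifferentiableAt ℝ ν x :=
  (P.contDiffAt_normal_and_alpha hx).1.differentiableAt (by simp)

theorem differentiableAt_alpha {x : E} (hx : x ∈ U) : DifferentiableAt ℝ α x :=
  (P.contDiffAt_normal_and_alpha hx).2.differentiableAt (by simp)

theorem inner_fderiv_normal {x : E} (hx : x ∈ U) (v : E) :
    inner ℝ (fderiv ℝ ν x v) (ν x) = (0 : ℝ) := by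
  have h1 := hasDerivAt_line (P.differentiableAt_normal hx) v
  have h2 := h1.inner ℝ h1
  have h3 : HasDerivAt (fun t : ℝ => (inner ℝ (ν (x + t • v)) (ν (x + t • v)) : ℝ)) 0 0 :=
    (hasDerivAt_const 0 (1 : ℝ)).congr_of_eventuallyEq <| by
      filter_upwards [eventually_line_mem P.isOpen hx v] with t ht using P.inner_self ht
  have h := h2.unique h3
  simp only [zero_smul, add_zero] at h
  rw [real_inner_comm] at h
  linarith

/-- The exterior derivative of `⟨ν, dZ⟩ = α θ`. -/
theorem structure_equation (hJ : IsComplexStructure J) {x : E} (hx : x ∈ U) (v w : E) :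
    inner ℝ (fderiv ℝ ν x v) (fderiv ℝ Z x w) - inner ℝ (fderiv ℝ ν x w) (fderiv ℝ Z x v)
      = fderiv ℝ α x v * contactPullback J Z τ x w - fderiv ℝ α x w * contactPullback J Z τ x v
        + 2 * α x * inner ℝ (J (fderiv ℝ Z x v)) (fderiv ℝ Z x w) := by
  have hZ := P.smooth_fst x hx
  have hτ := P.smooth_snd x hx
  -- The conormal relation evaluated on a fixed `w`, differentiated along `v`. Antisymmetrizing
  -- removes the second derivatives of `Z` and `τ`.
  have key : ∀ v w : E, inner ℝ (ν x) (fderiv ℝ (fderiv ℝ Z) x v w)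
      + inner ℝ (fderiv ℝ ν x v) (fderiv ℝ Z x w)
      = fderiv ℝ α x v * contactPullback J Z τ x w
        + α x * (fderiv ℝ (fderiv ℝ τ) x v w + (inner ℝ (J (Z x)) (fderiv ℝ (fderiv ℝ Z) x v w)
        + inner ℝ (J (fderiv ℝ Z x v)) (fderiv ℝ Z x w))) := by
    intro v w
    have h1 := (hasDerivAt_line (P.differentiableAt_normal hx) v).inner ℝ
      (hasDerivAt_fderiv_line hZ v w)
    have h2 := (hasDerivAt_line (P.differentiableAt_alpha hx) v).mul
      (hasDerivAt_contactPullback_line (J := J) hZ hτ v w)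
    have h := h1.unique (h2.congr_of_eventuallyEq <| by
      filter_upwards [eventually_line_mem P.isOpen hx v] with t ht using P.conormal _ ht w)
    simpa only [zero_smul, add_zero] using h
  have e1 := key v w
  have e2 := key w v
  rw [fderiv_fderiv_comm hZ w v, fderiv_fderiv_comm hτ w v,
    hJ.inner_left (fderiv ℝ Z x w),
    real_inner_comm (J (fderiv ℝ Z x v)) (fderiv ℝ Z x w)] at e2
  linear_combination e1 - e2

/-- The definition of l controls only the e_n component of dν(e_n). The defect `w` is orthogonal to
ν because |ν| = 1 and to e_n by the choice of l, so it lies in ξ'. The structure equation for e_n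
and a lift of `w`, where dν is known from umbilicity, then gives ⟨w, w⟩ = 0. -/
theorem fderiv_normal_principal (hJ : IsComplexStructure J) {x : E} (hx : x ∈ U) {v : E}
    (h1 : fderiv ℝ Z x v = -J (ν x)) (h2 : contactPullback J Z τ x v = 0) :
    fderiv ℝ ν x v = -(l x • -J (ν x)) := by
  set w : V := fderiv ℝ ν x v + l x • -J (ν x) with hw
  have hl := P.principal x hx v h2 h1
  have huu : (inner ℝ (J (ν x)) (J (ν x)) : ℝ) = 1 := by rw [hJ.inner_map, P.inner_self hx]
  have hν : inner ℝ (ν x) w = (0 : ℝ) := by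
    rw [hw, inner_add_right, real_inner_comm, P.inner_fderiv_normal hx]
    simp [inner_smul_right, hJ.inner_self_right]
  have hu : inner ℝ (-J (ν x)) w = (0 : ℝ) := by
    rw [hw, inner_add_right, hl, inner_smul_right, inner_neg_neg, huu]
    ring
  obtain ⟨v', h3, h4⟩ := P.surjective x hx w 0 (by rw [hν, mul_zero])
  have h5 := P.umbilic x hx v' h4 (by rw [h3, hu])
  have h6 := P.structure_equation hJ hx v' v
  rw [h5, h1, h2, h3, h4, inner_sub_left, inner_smul_left, inner_smul_left,
    real_inner_comm (-J (ν x)) w, hu, inner_neg_right, hJ.inner_map, real_inner_comm (ν x) w, hν,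
    eq_sub_of_add_eq hw.symm, inner_sub_left, inner_smul_left, hu] at h6
  simp only [mul_zero, neg_zero, sub_zero, zero_sub, add_zero, neg_eq_zero] at h6
  have hw0 : w = 0 := inner_self_eq_zero.1 h6
  exact eq_neg_of_add_eq_zero_left (hw.symm.trans hw0)

/-- The differential of the normal of an umbilic patch. -/
theorem fderiv_normal (hJ : IsComplexStructure J) {x : E} (hx : x ∈ U) (v : E) :
    fderiv ℝ ν x v = -(k x • fderiv ℝ Z x v) + α x • J (fderiv ℝ Z x v)
      + ((k x - l x) * inner ℝ (-J (ν x)) (fderiv ℝ Z x v)) • -J (ν x)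
      - (α x * inner ℝ (-J (ν x)) (fderiv ℝ Z x v)) • ν x
      + contactPullback J Z τ x v • ((k x * α x) • ν x + α x ^ 2 • -J (ν x)
        + fderiv ℝ ν x (tangentLift J Z τ x (α x • ν x, 1))) := by
  have huu : (inner ℝ (-J (ν x)) (-J (ν x)) : ℝ) = 1 := by
    rw [inner_neg_neg, hJ.inner_map, P.inner_self hx]
  have huν : (inner ℝ (-J (ν x)) (ν x) : ℝ) = 0 := by
    rw [inner_neg_left, hJ.inner_self_left, neg_zero]
  obtain ⟨a1, a2⟩ := P.tangentLift_spec hx (w := (α x • ν x, 1)) (by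
    rw [inner_smul_right, P.inner_self hx])
  obtain ⟨w, b1, b2⟩ := P.surjective x hx (-J (ν x)) 0 (by
    rw [inner_neg_right, hJ.inner_self_right, neg_zero, mul_zero])
  set e := tangentLift J Z τ x (α x • ν x, 1)
  set σ : ℝ := inner ℝ (-J (ν x)) (fderiv ℝ Z x v) with hσ
  set s : ℝ := contactPullback J Z τ x v with hs
  have hw := P.fderiv_normal_principal hJ hx b1 b2
  -- Umbilicity applies to the ξ' part of `v`, obtained by removing its e_n part and its part along
  -- αν + T.
  have h := P.umbilic x hx (v - σ • w - s • e)
    (by simp only [map_sub, map_smul, a2, b2, smul_eq_mul, ← hs]; ring)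
    (by
      simp only [map_sub, map_smul, a1, b1, inner_sub_right, inner_smul_right, huu, huν, ← hσ]
      ring)
  simp only [map_sub, map_smul, a1, b1, hw, map_neg, hJ.sq] at h
  rw [sub_sub, sub_eq_iff_eq_add] at h
  rw [h]
  module

end UmbilicPatch

end Patch

end HeisenbergUmbilic

namespace HeisenbergUmbilic

/-! ### Smoothness of k and l; the integrability condition d(dν) = 0 -/

section Patch

variable {E V : Type*} [NormedAddCommGroup E] [NormedSpace ℝ E]
  [NormedAddCommGroup V] [InnerProductSpace ℝ V]
  {J : V →L[ℝ] V} {U : Set E} {Z : E → V} {τ : E → ℝ} {ν : E → V} {α k l : E → ℝ}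

namespace UmbilicPatch

variable (P : UmbilicPatch J U Z τ ν α k l)
include P

theorem inner_charDir (hJ : IsComplexStructure J) {x : E} (hx : x ∈ U) :
    inner ℝ (-J (ν x)) (-J (ν x)) = (1 : ℝ) := by
  rw [inner_neg_neg, hJ.inner_map, P.inner_self hx]

theorem lift_charDir_spec (hJ : IsComplexStructure J) {x : E} (hx : x ∈ U) :
    fderiv ℝ Z x (tangentLift J Z τ x (-J (ν x), 0)) = -J (ν x) ∧
      contactPullback J Z τ x (tangentLift J Z τ x (-J (ν x), 0)) = 0 :=
  P.tangentLift_spec hx (w := (-J (ν x), 0)) (by rw [hJ.inner_neg_self, mul_zero])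

theorem lift_transverse_spec {x : E} (hx : x ∈ U) :
    fderiv ℝ Z x (tangentLift J Z τ x (α x • ν x, 1)) = α x • ν x ∧
      contactPullback J Z τ x (tangentLift J Z τ x (α x • ν x, 1)) = 1 :=
  P.tangentLift_spec hx (w := (α x • ν x, 1)) (by rw [inner_smul_right, P.inner_self hx])

variable [CompleteSpace E] [FiniteDimensional ℝ V]

theorem contDiffAt_fderiv_normal {x : E} (hx : x ∈ U) : ContDiffAt ℝ ∞ (fderiv ℝ ν) x :=
  (P.contDiffAt_normal_and_alpha hx).1.fderiv_right (by simp)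

theorem contDiffAt_charDir {x : E} (hx : x ∈ U) : ContDiffAt ℝ ∞ (fun y => -J (ν y)) x :=
  (J.contDiff.contDiffAt.comp x (P.contDiffAt_normal_and_alpha hx).1).neg

theorem contDiffAt_lift_transverse {x : E} (hx : x ∈ U) :
    ContDiffAt ℝ ∞ (fun y => tangentLift J Z τ y (α y • ν y, 1)) x := by
  obtain ⟨hν, hα⟩ := P.contDiffAt_normal_and_alpha hx
  refine P.contDiffAt_tangentLift (w := fun y => (α y • ν y, 1)) hx
    ((hα.smul hν).prodMk contDiffAt_const) fun y hy => ?_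
  simp only [inner_smul_right, P.inner_self hy]

theorem contDiffAt_lift_charDir (hJ : IsComplexStructure J) {x : E} (hx : x ∈ U) :
    ContDiffAt ℝ ∞ (fun y => tangentLift J Z τ y (-J (ν y), 0)) x :=
  P.contDiffAt_tangentLift (w := fun y => (-J (ν y), 0)) hx
    ((P.contDiffAt_charDir hx).prodMk contDiffAt_const) fun y hy => by
      rw [hJ.inner_neg_self, mul_zero]

theorem contDiffAt_fderiv_transverse {x : E} (hx : x ∈ U) :
    ContDiffAt ℝ ∞ (fun y => fderiv ℝ ν y (tangentLift J Z τ y (α y • ν y, 1))) x :=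
  (P.contDiffAt_fderiv_normal hx).clm_apply (P.contDiffAt_lift_transverse hx)

theorem contDiffAt_l (hJ : IsComplexStructure J) {x : E} (hx : x ∈ U) : ContDiffAt ℝ ∞ l x := by
  refine ((P.contDiffAt_charDir hx).inner ℝ ((P.contDiffAt_fderiv_normal hx).clm_apply
    (P.contDiffAt_lift_charDir hJ hx))).neg.congr_of_eventuallyEq ?_
  filter_upwards [P.isOpen.mem_nhds hx] with y hy
  have h := P.lift_charDir_spec hJ hy
  rw [P.principal y hy _ h.2 h.1, neg_neg]

/-- k is the Rayleigh quotient -⟨dν, b⟩ / ⟨b, b⟩ along any nonvanishing smooth field `b` in ξ'; the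
α J term of the shape operator drops out because J is skew. -/
theorem contDiffAt_k (hJ : IsComplexStructure J) {x : E} (hx : x ∈ U) : ContDiffAt ℝ ∞ k x := by
  obtain ⟨a, ha, haν, hau⟩ := P.exists_ne x hx
  have hs := P.contDiffAt_normal_and_alpha hx
  have hu := P.contDiffAt_charDir hx
  -- A fixed vector of ξ' at `x`, projected to ξ' at the nearby points.
  set b : E → V := fun y => a - (inner ℝ (ν y) a : ℝ) • ν y - (inner ℝ (-J (ν y)) a : ℝ) • -J (ν y)
    with hb
  have hbs : ContDiffAt ℝ ∞ b x := (contDiffAt_const.sub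
    ((hs.1.inner ℝ contDiffAt_const).smul hs.1)).sub ((hu.inner ℝ contDiffAt_const).smul hu)
  have hbx : b x ≠ 0 := by
    rw [hb]
    simpa [haν, hau] using ha
  have hbν : ∀ y ∈ U, inner ℝ (ν y) (b y) = (0 : ℝ) := fun y hy => by
    simp only [hb, inner_sub_right, inner_smul_right, P.inner_self hy, hJ.inner_neg_self]
    ring
  have hbu : ∀ y ∈ U, inner ℝ (-J (ν y)) (b y) = (0 : ℝ) := fun y hy => by
    simp only [hb, inner_sub_right, inner_smul_right, P.inner_charDir hJ hy,
      real_inner_comm (ν y) (-J (ν y)), hJ.inner_neg_self]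
    ring
  have hne : (inner ℝ (b x) (b x) : ℝ) ≠ 0 := inner_self_ne_zero.2 hbx
  have hlift : ContDiffAt ℝ ∞ (fun y => tangentLift J Z τ y (b y, 0)) x :=
    P.contDiffAt_tangentLift (w := fun y => (b y, 0)) hx (hbs.prodMk contDiffAt_const)
      fun y hy => by simp only [hbν y hy, mul_zero]
  have hbb := hbs.inner ℝ hbs
  refine (((P.contDiffAt_fderiv_normal hx).clm_apply hlift).inner ℝ hbs).neg.div hbb hne
    |>.congr_of_eventuallyEq ?_
  filter_upwards [P.isOpen.mem_nhds hx, hbb.continuousAt.eventually_ne hne] with y hy hyb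
  obtain ⟨h1, h2⟩ := P.tangentLift_spec hy (w := (b y, 0)) (by simp only [hbν y hy, mul_zero])
  rw [Pi.div_apply, P.umbilic y hy _ h2 (by rw [h1]; exact hbu y hy), h1]
  simp only [inner_sub_left, inner_smul_left, hJ.inner_self_left]
  rw [eq_div_iff hyb]
  simp

/-- The derivative along `v` of the formula for `⟨dν w, m⟩`, in which `C` is the coefficient of the
contact form. -/
theorem fderiv_fderiv_normal (hJ : IsComplexStructure J) {C : E → V}
    (hC : ∀ y ∈ U, C y = (k y * α y) • ν y + α y ^ 2 • -J (ν y)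
        + fderiv ℝ ν y (tangentLift J Z τ y (α y • ν y, 1)))
    {x : E} (hx : x ∈ U) (hCd : DifferentiableAt ℝ C x) (v w : E) (m : V) :
    inner ℝ (fderiv ℝ (fderiv ℝ ν) x v w) m
      = -(k x * inner ℝ (fderiv ℝ (fderiv ℝ Z) x v w) m + fderiv ℝ k x v * inner ℝ (fderiv ℝ Z x w) m)
      + (α x * inner ℝ (J (fderiv ℝ (fderiv ℝ Z) x v w)) m
        + fderiv ℝ α x v * inner ℝ (J (fderiv ℝ Z x w)) m)
      + ((k x - l x) * inner ℝ (-J (ν x)) (fderiv ℝ Z x w) * inner ℝ (-J (fderiv ℝ ν x v)) m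
        + ((k x - l x) * (inner ℝ (-J (ν x)) (fderiv ℝ (fderiv ℝ Z) x v w)
            + inner ℝ (-J (fderiv ℝ ν x v)) (fderiv ℝ Z x w))
          + (fderiv ℝ k x v - fderiv ℝ l x v) * inner ℝ (-J (ν x)) (fderiv ℝ Z x w))
          * inner ℝ (-J (ν x)) m)
      - (α x * inner ℝ (-J (ν x)) (fderiv ℝ Z x w) * inner ℝ (fderiv ℝ ν x v) m
        + (α x * (inner ℝ (-J (ν x)) (fderiv ℝ (fderiv ℝ Z) x v w)
            + inner ℝ (-J (fderiv ℝ ν x v)) (fderiv ℝ Z x w))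
          + fderiv ℝ α x v * inner ℝ (-J (ν x)) (fderiv ℝ Z x w)) * inner ℝ (ν x) m)
      + (contactPullback J Z τ x w * inner ℝ (fderiv ℝ C x v) m
        + (fderiv ℝ (fderiv ℝ τ) x v w + (inner ℝ (J (Z x)) (fderiv ℝ (fderiv ℝ Z) x v w)
        + inner ℝ (J (fderiv ℝ Z x v)) (fderiv ℝ Z x w))) * inner ℝ (C x) m) := by
  have hZ := P.smooth_fst x hx
  have hτ := P.smooth_snd x hx
  obtain ⟨hν, hα⟩ := P.contDiffAt_normal_and_alpha hx
  have dν := hasDerivAt_line (P.differentiableAt_normal hx) v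
  have dα := hasDerivAt_line (P.differentiableAt_alpha hx) v
  have dk := hasDerivAt_line ((P.contDiffAt_k hJ hx).differentiableAt (by simp)) v
  have dl := hasDerivAt_line ((P.contDiffAt_l hJ hx).differentiableAt (by simp)) v
  have dC := hasDerivAt_line hCd v
  have du := (J.hasFDerivAt.comp_hasDerivAt (0 : ℝ) dν).neg
  have dZ := hasDerivAt_fderiv_line hZ v w
  have dJZ := J.hasFDerivAt.comp_hasDerivAt (0 : ℝ) dZ
  have dθ := hasDerivAt_contactPullback_line (J := J) hZ hτ v w
  have dσ := du.inner ℝ dZ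
  have pair : ∀ {f : ℝ → V} {f' : V}, HasDerivAt f f' 0 →
      HasDerivAt (fun t => (inner ℝ (f t) m : ℝ)) (inner ℝ f' m) 0 := fun {f f'} hf => by
    simpa using hf.inner ℝ (hasDerivAt_const 0 m)
  have h1 := pair (hasDerivAt_fderiv_line hν v w)
  have h2 := ((((dk.mul (pair dZ)).neg.add (dα.mul (pair dJZ))).add
    (((dk.sub dl).mul dσ).mul (pair du))).sub ((dα.mul dσ).mul (pair dν))).add (dθ.mul (pair dC))
  have h := h1.unique (h2.congr_of_eventuallyEq <| by
    filter_upwards [eventually_line_mem P.isOpen hx v] with t ht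
    rw [P.fderiv_normal hJ ht w, ← hC _ ht]
    simp only [inner_add_left, inner_sub_left, inner_neg_left, inner_smul_left, Pi.add_apply,
      Pi.sub_apply, Pi.neg_apply, Pi.mul_apply, Function.comp_apply, conj_trivial])
  rw [h]
  simp only [zero_smul, add_zero, Function.comp_apply, Pi.sub_apply, Pi.neg_apply, Pi.mul_apply]
  ring

/-- The integrability condition `d(dν) = 0`. -/
theorem integrability (hJ : IsComplexStructure J) {C : E → V}
    (hC : ∀ y ∈ U, C y = (k y * α y) • ν y + α y ^ 2 • -J (ν y)
        + fderiv ℝ ν y (tangentLift J Z τ y (α y • ν y, 1)))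
    {x : E} (hx : x ∈ U) (hCd : DifferentiableAt ℝ C x) (v w : E) (m : V) :
    -(fderiv ℝ k x v * inner ℝ (fderiv ℝ Z x w) m - fderiv ℝ k x w * inner ℝ (fderiv ℝ Z x v) m)
      + (fderiv ℝ α x v * inner ℝ (J (fderiv ℝ Z x w)) m
        - fderiv ℝ α x w * inner ℝ (J (fderiv ℝ Z x v)) m)
      + (k x - l x) * (inner ℝ (-J (ν x)) (fderiv ℝ Z x w) * inner ℝ (-J (fderiv ℝ ν x v)) m
        - inner ℝ (-J (ν x)) (fderiv ℝ Z x v) * inner ℝ (-J (fderiv ℝ ν x w)) m)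
      + ((k x - l x) * (inner ℝ (-J (fderiv ℝ ν x v)) (fderiv ℝ Z x w)
            - inner ℝ (-J (fderiv ℝ ν x w)) (fderiv ℝ Z x v))
          + (fderiv ℝ k x v - fderiv ℝ l x v) * inner ℝ (-J (ν x)) (fderiv ℝ Z x w)
          - (fderiv ℝ k x w - fderiv ℝ l x w) * inner ℝ (-J (ν x)) (fderiv ℝ Z x v))
          * inner ℝ (-J (ν x)) m
      - α x * (inner ℝ (-J (ν x)) (fderiv ℝ Z x w) * inner ℝ (fderiv ℝ ν x v) m
        - inner ℝ (-J (ν x)) (fderiv ℝ Z x v) * inner ℝ (fderiv ℝ ν x w) m)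
      - (α x * (inner ℝ (-J (fderiv ℝ ν x v)) (fderiv ℝ Z x w)
            - inner ℝ (-J (fderiv ℝ ν x w)) (fderiv ℝ Z x v))
          + fderiv ℝ α x v * inner ℝ (-J (ν x)) (fderiv ℝ Z x w)
          - fderiv ℝ α x w * inner ℝ (-J (ν x)) (fderiv ℝ Z x v)) * inner ℝ (ν x) m
      + (contactPullback J Z τ x w * inner ℝ (fderiv ℝ C x v) m
        - contactPullback J Z τ x v * inner ℝ (fderiv ℝ C x w) m)
      + 2 * inner ℝ (J (fderiv ℝ Z x v)) (fderiv ℝ Z x w) * inner ℝ (C x) m = 0 := by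
  have hZ := P.smooth_fst x hx
  have hτ := P.smooth_snd x hx
  have e1 := P.fderiv_fderiv_normal hJ hC hx hCd v w m
  have e2 := P.fderiv_fderiv_normal hJ hC hx hCd w v m
  rw [fderiv_fderiv_comm hZ w v, fderiv_fderiv_comm hτ w v,
    fderiv_fderiv_comm (P.contDiffAt_normal_and_alpha hx).1 w v,
    hJ.inner_left (fderiv ℝ Z x w) (fderiv ℝ Z x v),
    real_inner_comm (J (fderiv ℝ Z x v)) (fderiv ℝ Z x w)] at e2
  linear_combination e2 - e1

end UmbilicPatch

end Patch

end HeisenbergUmbilic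

namespace HeisenbergUmbilic

set_option linter.unusedSimpArgs false

/-! ### Evaluating the structure equation and the integrability condition on pairs of directions -/

section Patch

variable {E V : Type*} [NormedAddCommGroup E] [NormedSpace ℝ E]
  [NormedAddCommGroup V] [InnerProductSpace ℝ V]

/-- The coefficient of the contact form in the formula for `dν`. -/
noncomputable def contactCoeff (J : V →L[ℝ] V) (Z : E → V) (τ : E → ℝ) (ν : E → V) (α k : E → ℝ)
    (x : E) : V :=
  (k x * α x) • ν x + α x ^ 2 • -J (ν x) + fderiv ℝ ν x (tangentLift J Z τ x (α x • ν x, 1))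

/-- The derivative of `α` in the direction `-J ν`. -/
noncomputable def charDeriv (J : V →L[ℝ] V) (Z : E → V) (τ : E → ℝ) (ν : E → V) (α : E → ℝ)
    (x : E) : ℝ :=
  fderiv ℝ α x (tangentLift J Z τ x (-J (ν x), 0))

variable {J : V →L[ℝ] V} {U : Set E} {Z : E → V} {τ : E → ℝ} {ν : E → V} {α k l : E → ℝ}

theorem fderiv_normal_lift_transverse (x : E) :
    fderiv ℝ ν x (tangentLift J Z τ x (α x • ν x, 1))
      = contactCoeff J Z τ ν α k x - (k x * α x) • ν x + α x ^ 2 • J (ν x) := by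
  rw [contactCoeff]
  module

/-- The tangent vectors in the maximal complex subspace. -/
structure IsComplexTangent (J : V →L[ℝ] V) (Z : E → V) (τ : E → ℝ) (ν : E → V) (x v : E) :
    Prop where
  contact : contactPullback J Z τ x v = 0
  normal : inner ℝ (ν x) (fderiv ℝ Z x v) = (0 : ℝ)
  char : inner ℝ (J (ν x)) (fderiv ℝ Z x v) = (0 : ℝ)

theorem IsComplexTangent.inner_eq_zero (hJ : IsComplexStructure J) {x v : E}
    (hv : IsComplexTangent J Z τ ν x v) :
    inner ℝ (fderiv ℝ Z x v) (ν x) = (0 : ℝ) ∧ inner ℝ (fderiv ℝ Z x v) (J (ν x)) = (0 : ℝ) ∧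
      inner ℝ (ν x) (J (fderiv ℝ Z x v)) = (0 : ℝ) ∧
      inner ℝ (J (fderiv ℝ Z x v)) (ν x) = (0 : ℝ) := by
  have h1 := (real_inner_comm (ν x) (fderiv ℝ Z x v)).trans hv.normal
  have h2 := (real_inner_comm (J (ν x)) (fderiv ℝ Z x v)).trans hv.char
  have h3 : inner ℝ (J (fderiv ℝ Z x v)) (ν x) = (0 : ℝ) := by rw [hJ.inner_left, h2, neg_zero]
  exact ⟨h1, h2, (real_inner_comm _ _).trans h3, h3⟩

namespace UmbilicPatch

variable (P : UmbilicPatch J U Z τ ν α k l)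
include P

theorem fderiv_normal_of_isComplexTangent {x : E} (hx : x ∈ U) {v : E}
    (hv : IsComplexTangent J Z τ ν x v) :
    fderiv ℝ ν x v = α x • J (fderiv ℝ Z x v) - k x • fderiv ℝ Z x v :=
  P.umbilic x hx v hv.contact (by rw [inner_neg_left, hv.char, neg_zero])

/-- The complex structure acts on the complex tangent vectors. -/
theorem exists_rotate (hJ : IsComplexStructure J) {x : E} (hx : x ∈ U) {v : E}
    (hv : IsComplexTangent J Z τ ν x v) :
    ∃ w, IsComplexTangent J Z τ ν x w ∧ fderiv ℝ Z x w = J (fderiv ℝ Z x v) := by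
  have h : inner ℝ (ν x) (J (fderiv ℝ Z x v)) = (0 : ℝ) := by
    rw [← neg_eq_zero, ← hJ.inner_left, hv.char]
  obtain ⟨w, h1, h2⟩ := P.surjective x hx (J (fderiv ℝ Z x v)) 0 (by rw [h, mul_zero])
  exact ⟨w, ⟨h2, by rw [h1, h], by rw [h1, hJ.inner_map, hv.normal]⟩, h1⟩

theorem exists_isComplexTangent {x : E} (hx : x ∈ U) :
    ∃ v, IsComplexTangent J Z τ ν x v ∧ fderiv ℝ Z x v ≠ 0 := by
  obtain ⟨a, ha, h1, h2⟩ := P.exists_ne x hx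
  obtain ⟨v, h3, h4⟩ := P.surjective x hx a 0 (by rw [h1, mul_zero])
  rw [inner_neg_left, neg_eq_zero] at h2
  exact ⟨v, ⟨h4, by rw [h3, h1], by rw [h3, h2]⟩, by rwa [h3]⟩

variable [CompleteSpace E] [FiniteDimensional ℝ V]

theorem inner_contactCoeff_normal (hJ : IsComplexStructure J) {x : E} (hx : x ∈ U) :
    inner ℝ (contactCoeff J Z τ ν α k x) (ν x) = k x * α x := by
  rw [contactCoeff]
  simp only [inner_add_left, inner_smul_left, inner_neg_left, P.inner_fderiv_normal hx,
    P.inner_self hx, hJ.inner_self_left, conj_trivial]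
  ring

/-- This is the structure equation on the pair (αν + T, e_n). -/
theorem inner_contactCoeff_char (hJ : IsComplexStructure J) {x : E} (hx : x ∈ U) :
    inner ℝ (contactCoeff J Z τ ν α k x) (J (ν x)) = charDeriv J Z τ ν α x + α x ^ 2 := by
  obtain ⟨h1, h2⟩ := P.lift_transverse_spec hx
  obtain ⟨h3, h4⟩ := P.lift_charDir_spec hJ hx
  have h := P.structure_equation hJ hx (tangentLift J Z τ x (α x • ν x, 1))
    (tangentLift J Z τ x (-J (ν x), 0))
  rw [h1, h2, h3, h4, P.fderiv_normal_principal hJ hx h3 h4] at h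
  simp only [inner_smul_left, inner_smul_right, inner_neg_left, inner_neg_right, map_smul,
    hJ.inner_map, P.inner_self hx, hJ.inner_self_left, conj_trivial] at h
  rw [contactCoeff, charDeriv]
  simp only [inner_add_left, inner_smul_left, inner_neg_left, hJ.inner_map, P.inner_self hx,
    hJ.inner_self_right, conj_trivial]
  linear_combination -h

/-- This is the structure equation on (αν + T, v). The ξ' part of C is thus minus the ξ' gradient of
α, so that C carries the information on whether α is constant along ξ'. -/
theorem inner_contactCoeff_complex (hJ : IsComplexStructure J) {x : E} (hx : x ∈ U) {v : E}
    (hv : IsComplexTangent J Z τ ν x v) :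
    inner ℝ (contactCoeff J Z τ ν α k x) (fderiv ℝ Z x v) = -fderiv ℝ α x v := by
  obtain ⟨h1, h2⟩ := P.lift_transverse_spec hx
  have h := P.structure_equation hJ hx (tangentLift J Z τ x (α x • ν x, 1)) v
  rw [h1, h2, hv.contact, P.fderiv_normal_of_isComplexTangent hx hv] at h
  simp only [inner_smul_left, inner_smul_right, inner_sub_left, hJ.inner_left (fderiv ℝ Z x v),
    real_inner_comm (J (ν x)) (fderiv ℝ Z x v), real_inner_comm (ν x) (fderiv ℝ Z x v), map_smul,
    hv.normal, hv.char, conj_trivial] at h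
  rw [contactCoeff]
  simp only [inner_add_left, inner_smul_left, inner_neg_left, hv.normal, hv.char, conj_trivial]
  linear_combination h

theorem differentiableAt_contactCoeff (hJ : IsComplexStructure J) {x : E} (hx : x ∈ U) :
    DifferentiableAt ℝ (contactCoeff J Z τ ν α k) x := by
  obtain ⟨hν, hα⟩ := P.contDiffAt_normal_and_alpha hx
  exact (((((P.contDiffAt_k hJ hx).mul hα).smul hν).add
    ((hα.pow 2).smul (P.contDiffAt_charDir hx))).add
    (P.contDiffAt_fderiv_transverse hx)).differentiableAt (by simp)

theorem contDiffAt_charDeriv (hJ : IsComplexStructure J) {x : E} (hx : x ∈ U) :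
    ContDiffAt ℝ ∞ (charDeriv J Z τ ν α) x :=
  ((P.contDiffAt_normal_and_alpha hx).2.fderiv_right (by simp)).clm_apply
    (P.contDiffAt_lift_charDir hJ hx)

theorem inner_fderiv_contactCoeff_char (hJ : IsComplexStructure J) {x : E} (hx : x ∈ U) (v : E) :
    inner ℝ (fderiv ℝ (contactCoeff J Z τ ν α k) x v) (J (ν x))
      = fderiv ℝ (charDeriv J Z τ ν α) x v + 2 * α x * fderiv ℝ α x v
        - inner ℝ (contactCoeff J Z τ ν α k x) (J (fderiv ℝ ν x v)) := by
  have d1 := (hasDerivAt_line (P.differentiableAt_contactCoeff hJ hx) v).inner ℝ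
    (J.hasFDerivAt.comp_hasDerivAt (0 : ℝ) (hasDerivAt_line (P.differentiableAt_normal hx) v))
  have d2 := (hasDerivAt_line ((P.contDiffAt_charDeriv hJ hx).differentiableAt (by simp)) v).add
    ((hasDerivAt_line (P.differentiableAt_alpha hx) v).pow 2)
  have h := d1.unique (d2.congr_of_eventuallyEq <| by
    filter_upwards [eventually_line_mem P.isOpen hx v] with t ht
    exact P.inner_contactCoeff_char hJ ht)
  simp only [zero_smul, add_zero, Function.comp_apply] at h
  push_cast at h
  linear_combination h

theorem fderiv_normal_lift_charDir (hJ : IsComplexStructure J) {x : E} (hx : x ∈ U) :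
    fderiv ℝ ν x (tangentLift J Z τ x (-J (ν x), 0)) = l x • J (ν x) := by
  obtain ⟨h1, h2⟩ := P.lift_charDir_spec hJ hx
  rw [P.fderiv_normal_principal hJ hx h1 h2, smul_neg, neg_neg]

/-- Integrability on (v, Jv), tested against e_n. This pair has zero contact form but dθ ≠ 0, so C
itself enters without its derivative, and its Jν component contains e_nα. -/
theorem charDeriv_eq (hJ : IsComplexStructure J) {x : E} (hx : x ∈ U) :
    charDeriv J Z τ ν α x = k x ^ 2 - α x ^ 2 - k x * l x := by
  obtain ⟨v, hv, hne⟩ := P.exists_isComplexTangent hx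
  obtain ⟨w, hw, hvw⟩ := P.exists_rotate hJ hx hv
  have h := P.integrability hJ (C := contactCoeff J Z τ ν α k) (fun _ _ => rfl) hx
    (P.differentiableAt_contactCoeff hJ hx) v w (-J (ν x))
  rw [P.fderiv_normal_of_isComplexTangent hx hv, P.fderiv_normal_of_isComplexTangent hx hw,
    hv.contact, hw.contact, hvw] at h
  obtain ⟨e1, e2, e3, e4⟩ := hv.inner_eq_zero hJ
  simp only [inner_neg_left, inner_neg_right, inner_sub_left, inner_smul_left, map_smul, map_sub,
    map_neg, hJ.sq, hJ.inner_map, hJ.inner_self_left, hJ.inner_self_right, conj_trivial, hv.normal,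
    hv.char, e1, e2, e3, e4, P.inner_self hx, P.inner_contactCoeff_char hJ hx] at h
  have h0 : (inner ℝ (fderiv ℝ Z x v) (fderiv ℝ Z x v) : ℝ) ≠ 0 := inner_self_ne_zero.2 hne
  apply mul_left_cancel₀ h0
  linear_combination -h / 2

/-- Integrability on (v, Jv), tested against Jv. The factor 3 consists of 1 from differentiating the
term α J dZ and 2 from the component of C along Jv. -/
theorem fderiv_k_eq_rotate (hJ : IsComplexStructure J) {x : E} (hx : x ∈ U) {v w : E}
    (hv : IsComplexTangent J Z τ ν x v) (hw : IsComplexTangent J Z τ ν x w)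
    (hvw : fderiv ℝ Z x w = J (fderiv ℝ Z x v)) (hne : fderiv ℝ Z x v ≠ 0) :
    fderiv ℝ k x v = -3 * fderiv ℝ α x w := by
  have h := P.integrability hJ (C := contactCoeff J Z τ ν α k) (fun _ _ => rfl) hx
    (P.differentiableAt_contactCoeff hJ hx) v w (J (fderiv ℝ Z x v))
  have hC := P.inner_contactCoeff_complex hJ hx hw
  rw [P.fderiv_normal_of_isComplexTangent hx hv, P.fderiv_normal_of_isComplexTangent hx hw,
    hv.contact, hw.contact, hvw] at h
  rw [hvw] at hC
  obtain ⟨e1, e2, e3, e4⟩ := hv.inner_eq_zero hJ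
  simp only [inner_neg_left, inner_sub_left, inner_smul_left, map_smul, map_sub,
    map_neg, hJ.sq, hJ.inner_map, hJ.inner_self_left, hJ.inner_self_right, conj_trivial, hv.normal,
    hv.char, e1, e2, e3, e4, hC] at h
  have h0 : (inner ℝ (fderiv ℝ Z x v) (fderiv ℝ Z x v) : ℝ) ≠ 0 := inner_self_ne_zero.2 hne
  apply mul_left_cancel₀ h0
  linear_combination -h

/-- Integrability on (v, e_n), tested against Jν: the two contributions of the derivative of k
cancel and only that of l survives. -/
theorem fderiv_l_complex (hJ : IsComplexStructure J) {x : E} (hx : x ∈ U) {v : E}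
    (hv : IsComplexTangent J Z τ ν x v) : fderiv ℝ l x v = 0 := by
  have h := P.integrability hJ (C := contactCoeff J Z τ ν α k) (fun _ _ => rfl) hx
    (P.differentiableAt_contactCoeff hJ hx) v (tangentLift J Z τ x (-J (ν x), 0)) (J (ν x))
  obtain ⟨h1, h2⟩ := P.lift_charDir_spec hJ hx
  rw [P.fderiv_normal_of_isComplexTangent hx hv, P.fderiv_normal_lift_charDir hJ hx,
    hv.contact, h1, h2] at h
  obtain ⟨e1, e2, e3, e4⟩ := hv.inner_eq_zero hJ
  simp only [inner_neg_left, inner_neg_right, inner_sub_left, inner_smul_left, map_smul, map_sub,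
    map_neg, hJ.sq, hJ.inner_map, hJ.inner_self_left, hJ.inner_self_right, conj_trivial, hv.normal,
    hv.char, e1, e2, e3, e4, P.inner_self hx] at h
  linear_combination h

/-- Integrability on (v, e_n), now tested against v itself. -/
theorem fderiv_k_charDir (hJ : IsComplexStructure J) {x : E} (hx : x ∈ U) :
    fderiv ℝ k x (tangentLift J Z τ x (-J (ν x), 0)) = (l x - 2 * k x) * α x := by
  obtain ⟨v, hv, hne⟩ := P.exists_isComplexTangent hx
  have h := P.integrability hJ (C := contactCoeff J Z τ ν α k) (fun _ _ => rfl) hx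
    (P.differentiableAt_contactCoeff hJ hx) v (tangentLift J Z τ x (-J (ν x), 0)) (fderiv ℝ Z x v)
  obtain ⟨h1, h2⟩ := P.lift_charDir_spec hJ hx
  rw [P.fderiv_normal_of_isComplexTangent hx hv, P.fderiv_normal_lift_charDir hJ hx,
    hv.contact, h1, h2] at h
  obtain ⟨e1, e2, e3, e4⟩ := hv.inner_eq_zero hJ
  simp only [inner_neg_left, inner_neg_right, inner_sub_left, inner_smul_left, map_smul, map_sub,
    map_neg, hJ.sq, hJ.inner_map, hJ.inner_self_left, hJ.inner_self_right, conj_trivial, hv.normal,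
    hv.char, e1, e2, e3, e4, P.inner_self hx] at h
  have h0 : (inner ℝ (fderiv ℝ Z x v) (fderiv ℝ Z x v) : ℝ) ≠ 0 := inner_self_ne_zero.2 hne
  apply mul_left_cancel₀ h0
  linear_combination h

/-- Integrability on (v, αν + T), tested against Jν. The derivative of C enters only through its Jν
component, where `inner_fderiv_contactCoeff_char` expresses it by e_nα and α. This computation is
independent of `charDeriv_eq`; comparing the two is what constrains α. -/
theorem fderiv_charDeriv_complex (hJ : IsComplexStructure J) {x : E} (hx : x ∈ U) {v w : E}
    (hv : IsComplexTangent J Z τ ν x v) (hw : IsComplexTangent J Z τ ν x w)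
    (hvw : fderiv ℝ Z x w = J (fderiv ℝ Z x v)) :
    fderiv ℝ (charDeriv J Z τ ν α) x v
      = -2 * α x * fderiv ℝ α x v + (2 * k x - l x) * fderiv ℝ α x w := by
  have h := P.integrability hJ (C := contactCoeff J Z τ ν α k) (fun _ _ => rfl) hx
    (P.differentiableAt_contactCoeff hJ hx) v (tangentLift J Z τ x (α x • ν x, 1)) (J (ν x))
  obtain ⟨h1, h2⟩ := P.lift_transverse_spec hx
  have hC := P.inner_contactCoeff_complex hJ hx hv
  have hC' := P.inner_contactCoeff_complex hJ hx hw
  rw [hvw] at hC'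
  rw [P.inner_fderiv_contactCoeff_char hJ hx,
    P.fderiv_normal_of_isComplexTangent hx hv, fderiv_normal_lift_transverse (k := k),
    hv.contact, h1, h2] at h
  obtain ⟨e1, e2, e3, e4⟩ := hv.inner_eq_zero hJ
  simp only [inner_neg_left, inner_neg_right, inner_sub_left, inner_sub_right, inner_add_left,
    inner_smul_left, inner_smul_right, map_smul, map_sub, map_add,
    map_neg, hJ.sq, hJ.inner_map, hJ.inner_self_left, hJ.inner_self_right, conj_trivial, hv.normal,
    hv.char, e1, e2, e3, e4, P.inner_self hx, hJ.inner_left (contactCoeff J Z τ ν α k x), hC, hC',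
    P.inner_contactCoeff_normal hJ hx, P.inner_contactCoeff_char hJ hx] at h
  linear_combination h

end UmbilicPatch

end Patch

end HeisenbergUmbilic

namespace HeisenbergUmbilic

set_option linter.unusedSimpArgs false

/-! ### Constancy along ξ' and the derivatives in the transverse direction -/

section Patch

variable {E V : Type*} [NormedAddCommGroup E] [NormedSpace ℝ E]
  [NormedAddCommGroup V] [InnerProductSpace ℝ V]
  {J : V →L[ℝ] V} {U : Set E} {Z : E → V} {τ : E → ℝ} {ν : E → V} {α k l : E → ℝ}

namespace UmbilicPatch

variable (P : UmbilicPatch J U Z τ ν α k l)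
include P

theorem eq_neg_of_rotate_rotate (hJ : IsComplexStructure J) {x : E} (hx : x ∈ U) {u v w : E}
    (hu : IsComplexTangent J Z τ ν x u) (hw : IsComplexTangent J Z τ ν x w)
    (huv : fderiv ℝ Z x v = J (fderiv ℝ Z x u)) (hvw : fderiv ℝ Z x w = J (fderiv ℝ Z x v)) :
    w = -u :=
  P.eq_of_eq hx (by rw [hvw, huv, hJ.sq, map_neg]) (by rw [hw.contact, map_neg, hu.contact, neg_zero])

variable [CompleteSpace E] [FiniteDimensional ℝ V]

theorem fderiv_charDeriv (hJ : IsComplexStructure J) {x : E} (hx : x ∈ U) (v : E) :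
    fderiv ℝ (charDeriv J Z τ ν α) x v = 2 * k x * fderiv ℝ k x v - 2 * α x * fderiv ℝ α x v
      - fderiv ℝ k x v * l x - k x * fderiv ℝ l x v := by
  have dα := hasDerivAt_line (P.differentiableAt_alpha hx) v
  have dk := hasDerivAt_line ((P.contDiffAt_k hJ hx).differentiableAt (by simp)) v
  have dl := hasDerivAt_line ((P.contDiffAt_l hJ hx).differentiableAt (by simp)) v
  have dA := hasDerivAt_line ((P.contDiffAt_charDeriv hJ hx).differentiableAt (by simp)) v
  have h := dA.unique ((((dk.pow 2).sub (dα.pow 2)).sub (dk.mul dl)).congr_of_eventuallyEq <| by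
    filter_upwards [eventually_line_mem P.isOpen hx v] with t ht
    exact P.charDeriv_eq hJ ht)
  simp only [zero_smul, add_zero] at h
  push_cast at h
  linear_combination h

/-- The derivative of e_nα along Jv is computed twice: from the closed formula `charDeriv_eq`, where
k contributes 3 (2k - l) vα, and from integrability, which contributes -(2k - l) vα. The difference
is 4 (2k - l) vα. Working along Jv makes the second rotation equal to -v. -/
theorem two_mul_k_sub_l_mul (hJ : IsComplexStructure J) {x : E} (hx : x ∈ U) {v : E}
    (hv : IsComplexTangent J Z τ ν x v) (hne : fderiv ℝ Z x v ≠ 0) :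
    (2 * k x - l x) * fderiv ℝ α x v = 0 := by
  obtain ⟨w, hw, hvw⟩ := P.exists_rotate hJ hx hv
  obtain ⟨u, hu, hwu⟩ := P.exists_rotate hJ hx hw
  have hw0 : fderiv ℝ Z x w ≠ 0 := fun h0 => hne <| by
    rw [← neg_eq_zero, ← hJ.sq, ← hvw, h0, map_zero]
  have e1 := P.fderiv_charDeriv hJ hx w
  have e2 := P.fderiv_charDeriv_complex hJ hx hw hu hwu
  have e3 := P.fderiv_k_eq_rotate hJ hx hw hu hwu hw0
  rw [P.fderiv_l_complex hJ hx hw] at e1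
  rw [P.eq_neg_of_rotate_rotate hJ hx hv hu hvw hwu, map_neg] at e2 e3
  linear_combination (e1 - e2 + (2 * k x - l x) * e3) / (-4)

/-- A pointwise relation (2k - l) vα = 0 does not suffice, since l = 2k must be differentiated.
Nonvanishing of the ξ' gradient of α is an open condition, so l = 2k holds on a neighbourhood. -/
theorem fderiv_alpha_complex (hJ : IsComplexStructure J) {x : E} (hx : x ∈ U) {v : E}
    (hv : IsComplexTangent J Z τ ν x v) : fderiv ℝ α x v = 0 := by
  by_contra hne
  have hv0 : fderiv ℝ Z x v ≠ 0 := fun h0 => hne <| by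
    rw [P.injective x hx v h0 hv.contact, map_zero]
  set C := contactCoeff J Z τ ν α k with hC
  -- The projection of C to ξ', that is, minus the ξ' gradient of α.
  set g : E → V := fun y => C y - (inner ℝ (C y) (ν y) : ℝ) • ν y
    - (inner ℝ (C y) (J (ν y)) : ℝ) • J (ν y) with hg
  have hCc : ContinuousAt C x := (P.differentiableAt_contactCoeff hJ hx).continuousAt
  have hνc := P.continuousAt x hx
  have hJc : ContinuousAt (fun y => J (ν y)) x := J.continuous.continuousAt.comp hνc
  have hgc : ContinuousAt g x :=
    (hCc.sub ((hCc.inner hνc).smul hνc)).sub ((hCc.inner hJc).smul hJc)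
  have hgx : g x ≠ 0 := fun h0 => hne <| by
    have h1 : (inner ℝ (g x) (fderiv ℝ Z x v) : ℝ) = 0 := by rw [h0, inner_zero_left]
    simp only [hg, inner_sub_left, inner_smul_left, hv.normal, hv.char] at h1
    rw [P.inner_contactCoeff_complex hJ hx hv] at h1
    linarith
  have hkl : ∀ᶠ y in nhds x, l y = 2 * k y := by
    filter_upwards [P.isOpen.mem_nhds hx, hgc.eventually_ne hgx] with y hy hgy
    have h1 : (inner ℝ (ν y) (g y) : ℝ) = 0 := by
      simp only [hg, inner_sub_right, inner_smul_right, P.inner_self hy, hJ.inner_self_right,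
        real_inner_comm (C y) (ν y)]
      ring
    have h2 : (inner ℝ (J (ν y)) (g y) : ℝ) = 0 := by
      simp only [hg, inner_sub_right, inner_smul_right, hJ.inner_map, P.inner_self hy,
        hJ.inner_self_left, real_inner_comm (C y) (J (ν y))]
      ring
    obtain ⟨w, h3, h4⟩ := P.surjective y hy (g y) 0 (by rw [h1, mul_zero])
    have hw : IsComplexTangent J Z τ ν y w := ⟨h4, by rw [h3, h1], by rw [h3, h2]⟩
    have h5 := P.two_mul_k_sub_l_mul hJ hy hw (by rwa [h3])
    have h6 := P.inner_contactCoeff_complex hJ hy hw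
    have h7 : (inner ℝ (g y) (g y) : ℝ) = inner ℝ (C y) (g y) := by
      change inner ℝ (C y - (inner ℝ (C y) (ν y) : ℝ) • ν y
        - (inner ℝ (C y) (J (ν y)) : ℝ) • J (ν y)) (g y) = _
      rw [inner_sub_left, inner_sub_left, inner_smul_left, inner_smul_left, h1, h2]
      ring
    have h8 : fderiv ℝ α y w ≠ 0 := fun h0 => by
      rw [h0, neg_zero, h3, ← hC, ← h7] at h6
      exact hgy (inner_self_eq_zero.1 h6)
    have h9 := (mul_eq_zero.1 h5).resolve_right h8
    linarith
  have hdl : fderiv ℝ l x = (2 : ℝ) • fderiv ℝ k x := by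
    rw [Filter.EventuallyEq.fderiv_eq (f := fun y => 2 * k y) hkl]
    exact fderiv_const_mul ((P.contDiffAt_k hJ hx).differentiableAt (by simp)) 2
  obtain ⟨w, hw, hvw⟩ := P.exists_rotate hJ hx hv
  obtain ⟨u, hu, hwu⟩ := P.exists_rotate hJ hx hw
  have hw0 : fderiv ℝ Z x w ≠ 0 := fun h0 => hv0 <| by
    rw [← neg_eq_zero, ← hJ.sq, ← hvw, h0, map_zero]
  -- Along Jv, l is constant, hence so is k = l/2; but the derivative of k there is 3 vα.
  have e3 := P.fderiv_k_eq_rotate hJ hx hw hu hwu hw0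
  have e4 := P.fderiv_l_complex hJ hx hw
  rw [P.eq_neg_of_rotate_rotate hJ hx hv hu hvw hwu, map_neg] at e3
  rw [hdl] at e4
  simp only [smul_apply, smul_eq_mul] at e4
  exact hne (by linarith)

theorem fderiv_k_complex (hJ : IsComplexStructure J) {x : E} (hx : x ∈ U) {v : E}
    (hv : IsComplexTangent J Z τ ν x v) : fderiv ℝ k x v = 0 := by
  by_cases h0 : fderiv ℝ Z x v = 0
  · rw [P.injective x hx v h0 hv.contact, map_zero]
  · obtain ⟨w, hw, hvw⟩ := P.exists_rotate hJ hx hv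
    rw [P.fderiv_k_eq_rotate hJ hx hv hw hvw h0, P.fderiv_alpha_complex hJ hx hw, mul_zero]

theorem fderiv_charDeriv_complex_eq_zero (hJ : IsComplexStructure J) {x : E} (hx : x ∈ U) {v : E}
    (hv : IsComplexTangent J Z τ ν x v) : fderiv ℝ (charDeriv J Z τ ν α) x v = 0 := by
  rw [P.fderiv_charDeriv hJ hx, P.fderiv_k_complex hJ hx hv, P.fderiv_l_complex hJ hx hv,
    P.fderiv_alpha_complex hJ hx hv]
  ring

/-- Once α is constant along ξ', C has no ξ' component, so the two components already known
determine it. -/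
theorem contactCoeff_eq (hJ : IsComplexStructure J) {x : E} (hx : x ∈ U) :
    contactCoeff J Z τ ν α k x
      = (k x * α x) • ν x + (charDeriv J Z τ ν α x + α x ^ 2) • J (ν x) := by
  set g : V := contactCoeff J Z τ ν α k x
      - ((k x * α x) • ν x + (charDeriv J Z τ ν α x + α x ^ 2) • J (ν x)) with hg
  have h1 : (inner ℝ g (ν x) : ℝ) = 0 := by
    simp only [hg, inner_sub_left, inner_add_left, inner_smul_left, P.inner_self hx,
      hJ.inner_self_left, P.inner_contactCoeff_normal hJ hx, conj_trivial]
    ring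
  have h2 : (inner ℝ g (J (ν x)) : ℝ) = 0 := by
    simp only [hg, inner_sub_left, inner_add_left, inner_smul_left, P.inner_self hx,
      hJ.inner_self_right, hJ.inner_map, P.inner_contactCoeff_char hJ hx, conj_trivial]
    ring
  have h1' := (real_inner_comm g (ν x)).trans h1
  have h2' := (real_inner_comm g (J (ν x))).trans h2
  obtain ⟨w, h3, h4⟩ := P.surjective x hx g 0 (by rw [h1', mul_zero])
  have hw : IsComplexTangent J Z τ ν x w := ⟨h4, by rw [h3, h1'], by rw [h3, h2']⟩
  have h5 := P.inner_contactCoeff_complex hJ hx hw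
  rw [P.fderiv_alpha_complex hJ hx hw, h3, neg_zero, eq_add_of_sub_eq hg.symm] at h5
  simp only [inner_add_left, inner_smul_left, h1', h2', mul_zero, add_zero] at h5
  exact sub_eq_zero.1 (hg.symm.trans (inner_self_eq_zero.1 h5))

/-- For `m` in ξ' the derivatives of the scalar coefficients of C are multiplied by ⟨ν, m⟩ or ⟨Jν,
m⟩ and disappear; only `dν` remains. -/
theorem inner_fderiv_contactCoeff (hJ : IsComplexStructure J) {x : E} (hx : x ∈ U) (v : E) (m : V)
    (h1 : inner ℝ (ν x) m = (0 : ℝ)) (h2 : inner ℝ (J (ν x)) m = (0 : ℝ)) :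
    inner ℝ (fderiv ℝ (contactCoeff J Z τ ν α k) x v) m
      = k x * α x * inner ℝ (fderiv ℝ ν x v) m
        + (charDeriv J Z τ ν α x + α x ^ 2) * inner ℝ (J (fderiv ℝ ν x v)) m := by
  have dν := hasDerivAt_line (P.differentiableAt_normal hx) v
  have dα := hasDerivAt_line (P.differentiableAt_alpha hx) v
  have dk := hasDerivAt_line ((P.contDiffAt_k hJ hx).differentiableAt (by simp)) v
  have dA := hasDerivAt_line ((P.contDiffAt_charDeriv hJ hx).differentiableAt (by simp)) v
  have dC := hasDerivAt_line (P.differentiableAt_contactCoeff hJ hx) v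
  have h := dC.unique ((((dk.mul dα).smul dν).add ((dA.add (dα.pow 2)).smul
    (J.hasFDerivAt.comp_hasDerivAt (0 : ℝ) dν))).congr_of_eventuallyEq <| by
    filter_upwards [eventually_line_mem P.isOpen hx v] with t ht
    exact P.contactCoeff_eq hJ ht)
  rw [h]
  simp [inner_add_left, inner_smul_left, h1, h2]

/-- The derivatives in the transverse direction `α ν + T`. -/
theorem fderiv_k_and_alpha_transverse (hJ : IsComplexStructure J) {x : E} (hx : x ∈ U) :
    fderiv ℝ k x (tangentLift J Z τ x (α x • ν x, 1))
        = α x * (k x ^ 2 + charDeriv J Z τ ν α x + α x ^ 2) ∧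
      fderiv ℝ α x (tangentLift J Z τ x (α x • ν x, 1)) = -k x * charDeriv J Z τ ν α x := by
  obtain ⟨v, hv, hne⟩ := P.exists_isComplexTangent hx
  obtain ⟨h1, h2⟩ := P.lift_transverse_spec hx
  obtain ⟨e1, e2, e3, e4⟩ := hv.inner_eq_zero hJ
  have h0 : (inner ℝ (fderiv ℝ Z x v) (fderiv ℝ Z x v) : ℝ) ≠ 0 := inner_self_ne_zero.2 hne
  have hm : inner ℝ (J (ν x)) (J (fderiv ℝ Z x v)) = (0 : ℝ) := by rw [hJ.inner_map, hv.normal]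
  constructor
  -- Testing against v isolates the derivative of k.
  · have h := P.integrability hJ (C := contactCoeff J Z τ ν α k) (fun _ _ => rfl) hx
      (P.differentiableAt_contactCoeff hJ hx) v (tangentLift J Z τ x (α x • ν x, 1))
      (fderiv ℝ Z x v)
    rw [P.inner_fderiv_contactCoeff hJ hx _ _ hv.normal hv.char,
      P.fderiv_normal_of_isComplexTangent hx hv, fderiv_normal_lift_transverse (k := k),
      P.contactCoeff_eq hJ hx, hv.contact, h1, h2] at h
    simp only [inner_neg_left, inner_neg_right, inner_sub_left, inner_sub_right, inner_add_left,
      inner_smul_left, inner_smul_right, map_smul, map_sub, map_add,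
      map_neg, hJ.sq, hJ.inner_map, hJ.inner_self_left, hJ.inner_self_right, conj_trivial,
      hv.normal, hv.char, e1, e2, e3, e4, P.inner_self hx] at h
    apply mul_left_cancel₀ h0
    linear_combination h
  -- Testing against Jv isolates the derivative of α.
  · have h := P.integrability hJ (C := contactCoeff J Z τ ν α k) (fun _ _ => rfl) hx
      (P.differentiableAt_contactCoeff hJ hx) v (tangentLift J Z τ x (α x • ν x, 1))
      (J (fderiv ℝ Z x v))
    rw [P.inner_fderiv_contactCoeff hJ hx _ _ e3 hm,
      P.fderiv_normal_of_isComplexTangent hx hv, fderiv_normal_lift_transverse (k := k),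
      P.contactCoeff_eq hJ hx, hv.contact, h1, h2] at h
    simp only [inner_neg_left, inner_neg_right, inner_sub_left, inner_sub_right, inner_add_left,
      inner_smul_left, inner_smul_right, map_smul, map_sub, map_add,
      map_neg, hJ.sq, hJ.inner_map, hJ.inner_self_left, hJ.inner_self_right, conj_trivial,
      hv.normal, hv.char, e1, e2, e3, e4, P.inner_self hx] at h
    apply mul_left_cancel₀ h0
    linear_combination -h

/-- Integrability on the one remaining pair, (e_n, αν + T), tested against Jν. The term e_ne_nα
comes from differentiating the Jν component of C. -/
theorem fderiv_l_transverse (hJ : IsComplexStructure J) {x : E} (hx : x ∈ U) :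
    fderiv ℝ l x (tangentLift J Z τ x (α x • ν x, 1))
      = fderiv ℝ (charDeriv J Z τ ν α) x (tangentLift J Z τ x (-J (ν x), 0))
        + 6 * α x * charDeriv J Z τ ν α x + 4 * α x ^ 3 + α x * l x ^ 2 := by
  obtain ⟨h1, h2⟩ := P.lift_transverse_spec hx
  obtain ⟨h3, h4⟩ := P.lift_charDir_spec hJ hx
  have h := P.integrability hJ (C := contactCoeff J Z τ ν α k) (fun _ _ => rfl) hx
    (P.differentiableAt_contactCoeff hJ hx) (tangentLift J Z τ x (-J (ν x), 0))
    (tangentLift J Z τ x (α x • ν x, 1)) (J (ν x))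
  have hA : fderiv ℝ α x (tangentLift J Z τ x (-J (ν x), 0)) = charDeriv J Z τ ν α x := rfl
  rw [P.inner_fderiv_contactCoeff_char hJ hx, P.fderiv_normal_lift_charDir hJ hx,
    fderiv_normal_lift_transverse (k := k), P.contactCoeff_eq hJ hx, h1, h2, h3, h4, hA,
    P.fderiv_k_charDir hJ hx] at h
  obtain ⟨e5, e6⟩ := P.fderiv_k_and_alpha_transverse hJ hx
  rw [e5, e6] at h
  simp only [inner_neg_left, inner_neg_right, inner_sub_left, inner_sub_right, inner_add_left,
    inner_smul_left, inner_smul_right, map_smul, map_sub, map_add,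
    map_neg, hJ.sq, hJ.inner_map, hJ.inner_self_left, hJ.inner_self_right, conj_trivial,
    P.inner_self hx] at h
  linear_combination -h

end UmbilicPatch

end Patch

end HeisenbergUmbilic

namespace HeisenbergUmbilic

/-! ### Linear algebra of the left-invariant frame -/

section Heisenberg

variable {n : ℕ}

theorem J_J (a : Hor n) : J n (J n a) = -a := by
  ext i
  rcases i with j | j <;> simp [J]

theorem inner_J_J (a b : Hor n) : inner ℝ (J n a) (J n b) = (inner ℝ a b : ℝ) := by
  simp [J, PiLp.inner_apply, Fintype.sum_sum_type, add_comm]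

theorem inner_J_left (a b : Hor n) : inner ℝ (J n a) b = -(inner ℝ a (J n b) : ℝ) := by
  rw [← inner_J_J (J n a) b, J_J, inner_neg_left]

/-- The complex structure of the Heisenberg group as a continuous linear map. -/
noncomputable def complexStructure (n : ℕ) : Hor n →L[ℝ] Hor n :=
  LinearMap.toContinuousLinearMap (J n)

@[simp]
theorem complexStructure_apply (a : Hor n) : complexStructure n a = J n a := rfl

theorem isComplexStructure (n : ℕ) : IsComplexStructure (complexStructure n) :=
  ⟨J_J, inner_J_J⟩

theorem Theta_apply (q w : Heis n) : Theta q w = w.2 + inner ℝ (J n q.1) w.1 := by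
  change w.2 + ∑ j : Fin n, (q.1 (Sum.inl j) * w.1 (Sum.inr j)
    - q.1 (Sum.inr j) * w.1 (Sum.inl j)) = _
  simp [J, PiLp.inner_apply, Fintype.sum_sum_type, Finset.sum_sub_distrib, mul_comm]
  ring

theorem Theta_hor (q : Heis n) (a : Hor n) : Theta q (hor q a) = 0 := by
  have h : hor q a ∈ contactPlane q := by rw [← range_hor]; exact ⟨a, rfl⟩
  exact h

theorem hor_fst (q : Heis n) (a : Hor n) : (hor q a).1 = a := rfl

theorem Theta_T (q : Heis n) : Theta q (T n) = 1 := by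
  rw [Theta_apply]; simp [T]

theorem ext_of_fst_of_Theta (q : Heis n) {v w : Heis n} (h1 : v.1 = w.1)
    (h2 : Theta q v = Theta q w) : v = w := by
  rw [Theta_apply, Theta_apply, h1, add_left_inj] at h2
  exact Prod.ext h1 h2

theorem hor_eq_of_Theta_eq_zero (q : Heis n) {w : Heis n} (h : Theta q w = 0) :
    hor q w.1 = w :=
  ext_of_fst_of_Theta q rfl (by rw [Theta_hor, h])

theorem finrank_heis : Module.finrank ℝ (Heis n) = 2 * n + 1 := by
  simp [Heis, Hor, two_mul]

end Heisenberg

/-! ### The tangent hyperplane described by e_n and α -/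

section Hypersurface

variable {n : ℕ} {M : Type*} [TopologicalSpace M]
  [ChartedSpace (EuclideanSpace ℝ (Fin (2 * n))) M]

theorem finrank_tangent {φ : M → Heis n} {p : M} (h : Function.Injective (diff φ p)) :
    Module.finrank ℝ (tangent φ p) = 2 * n := by
  have h1 : Module.finrank ℝ (TangentSpace (𝓡 (2 * n)) p) = 2 * n :=
    finrank_euclideanSpace_fin
  rw [← h1]
  exact LinearMap.finrank_range_of_inj h

/-- At a regular point, the tangent hyperplane meets the contact plane in the orthogonal complement
of a nonzero horizontal vector. -/
theorem exists_horizontal_normal {φ : M → Heis n} {p : M} (h : Function.Injective (diff φ p))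
    (hp : IsRegular φ p) :
    ∃ μ : Hor n, μ ≠ 0 ∧ ∀ a, a ∈ horTangent φ p ↔ inner ℝ μ a = (0 : ℝ) := by
  have hlt : tangent φ p < ⊤ := by
    refine lt_top_iff_ne_top.2 fun h0 => ?_
    have h1 := finrank_tangent h
    rw [h0, finrank_top, finrank_heis] at h1
    omega
  obtain ⟨f, hf0, hf⟩ := Submodule.exists_le_ker_of_lt_top _ hlt
  have hker : tangent φ p = LinearMap.ker f := by
    refine Submodule.eq_of_le_of_finrank_eq hf ?_
    have h1 := LinearMap.finrank_range_add_finrank_ker f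
    have h2 : Module.finrank ℝ (LinearMap.range f) = 1 := by
      rw [LinearMap.range_eq_top.2 (LinearMap.surjective hf0), finrank_top, Module.finrank_self]
    rw [finrank_heis] at h1
    rw [finrank_tangent h]
    omega
  set F : Hor n →L[ℝ] ℝ := LinearMap.toContinuousLinearMap (f ∘ₗ hor (φ p)) with hF
  have hμ : ∀ a, inner ℝ ((InnerProductSpace.toDual ℝ (Hor n)).symm F) a = f (hor (φ p) a) :=
    fun a => InnerProductSpace.toDual_symm_apply
  -- The normal is the Riesz vector of a functional with kernel TΣ, restricted to ξ. If it vanished,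
  -- TΣ would contain ξ and equal it by dimension, against regularity.
  refine ⟨(InnerProductSpace.toDual ℝ (Hor n)).symm F, fun h0 => hp ?_, fun a => ?_⟩
  · have hle : contactPlane (φ p) ≤ tangent φ p := by
      rw [hker, ← range_hor]
      rintro _ ⟨a, rfl⟩
      rw [LinearMap.mem_ker, ← hμ, h0, inner_zero_left]
    refine (Submodule.eq_of_le_of_finrank_eq hle ?_).symm
    have h1 := LinearMap.finrank_range_add_finrank_ker (Theta (φ p))
    have h2 : Module.finrank ℝ (LinearMap.range (Theta (φ p))) = 1 := by
      rw [LinearMap.range_eq_top.2 (LinearMap.surjective fun h3 => ?_), finrank_top,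
        Module.finrank_self]
      have h4 := Theta_T (φ p)
      rw [h3] at h4
      simp at h4
    rw [finrank_heis] at h1
    rw [finrank_tangent h, contactPlane]
    omega
  · rw [hμ, horTangent, Submodule.mem_comap, hker, LinearMap.mem_ker]

namespace IsAdapted

variable {φ : M → Heis n} {W : Set M} {en : M → Hor n} {α : M → ℝ} (hen : IsAdapted φ W en α)
include hen

theorem inner_self {p : M} (hp : p ∈ W) : inner ℝ (en p) (en p) = (1 : ℝ) := by
  rw [real_inner_self_eq_norm_sq, hen.norm_eq_one p hp, one_pow]

/-- With ξ ∩ TΣ = μ^⊥, the space ξ' is the orthogonal complement of μ and Jμ. The part of e_n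
orthogonal to Jμ lies in ξ', hence vanishes, so e_n is a multiple of Jμ and Je_n one of μ. -/
theorem mem_horTangent_iff {p : M} (hp : p ∈ W) (h : Function.Injective (diff φ p)) (a : Hor n) :
    a ∈ horTangent φ p ↔ inner ℝ (J n (en p)) a = (0 : ℝ) := by
  obtain ⟨μ, hμ0, hμ⟩ := exists_horizontal_normal h (hen.regular p hp)
  have hμμ : (inner ℝ μ μ : ℝ) ≠ 0 := inner_self_ne_zero.2 hμ0
  have hJμ : inner ℝ μ (J n μ) = (0 : ℝ) := (isComplexStructure n).inner_self_right μ
  have hJμ' : inner ℝ (J n μ) μ = (0 : ℝ) := (isComplexStructure n).inner_self_left μ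
  have hμe : inner ℝ μ (en p) = (0 : ℝ) := (hμ _).1 (hen.mem_horTangent p hp)
  set c : ℝ := inner ℝ (J n μ) (en p) / inner ℝ μ μ with hc
  set y : Hor n := en p - c • J n μ with hy
  have hyμ : inner ℝ μ y = (0 : ℝ) := by
    rw [hy, inner_sub_right, inner_smul_right, hμe, hJμ]; ring
  have hyJ : inner ℝ (J n μ) y = (0 : ℝ) := by
    rw [hy, inner_sub_right, inner_smul_right, inner_J_J, hc]; field_simp; ring
  have hyx : y ∈ xiPrime φ p := by
    refine ⟨(hμ y).2 hyμ, -J n y, (hμ _).2 ?_, by rw [map_neg, J_J, neg_neg]⟩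
    rw [inner_neg_right, ← inner_J_left, hyJ]
  have h1 : inner ℝ y (en p) = (0 : ℝ) := (hen.mem_orthogonal p hp) y hyx
  have h2 : inner ℝ y y = (0 : ℝ) := by
    have h3 : inner ℝ y y = (inner ℝ y (en p) - c * inner ℝ y (J n μ) : ℝ) := by
      rw [← inner_smul_right, ← inner_sub_right]
    rw [h3, h1, real_inner_comm, hyJ, mul_zero, sub_zero]
  have h3 : en p = c • J n μ := sub_eq_zero.1 (inner_self_eq_zero.1 h2)
  have hc0 : c ≠ 0 := by
    rintro h0
    have := hen.norm_eq_one p hp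
    rw [h3, h0] at this
    simp at this
  rw [hμ, h3, map_smul, J_J, inner_smul_left, inner_neg_left]
  simp [hc0]

theorem mem_xiPrime_iff {p : M} (hp : p ∈ W) (h : Function.Injective (diff φ p)) (a : Hor n) :
    a ∈ xiPrime φ p ↔ inner ℝ (J n (en p)) a = (0 : ℝ) ∧ inner ℝ (en p) a = (0 : ℝ) := by
  rw [xiPrime, Submodule.mem_inf, hen.mem_horTangent_iff hp h]
  refine and_congr_right fun _ => ⟨?_, fun h1 => ⟨-J n a, ?_, by rw [map_neg, J_J, neg_neg]⟩⟩
  · rintro ⟨b, hb, rfl⟩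
    rw [SetLike.mem_coe, hen.mem_horTangent_iff hp h, inner_J_left, neg_eq_zero] at hb
    exact hb
  · rw [SetLike.mem_coe, hen.mem_horTangent_iff hp h, inner_neg_right, inner_J_J, h1, neg_zero]

/-- The tangent vector αe_{2n} + T has contact form 1; subtracting the right multiple of it reduces
to horizontal vectors. -/
theorem mem_tangent_iff {p : M} (hp : p ∈ W) (h : Function.Injective (diff φ p)) (w : Heis n) :
    w ∈ tangent φ p ↔ inner ℝ (J n (en p)) w.1 = α p * Theta (φ p) w := by
  have hs := hen.alpha_spec p hp
  set E := α p • hor (φ p) (J n (en p)) + T n with hE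
  have hE1 : Theta (φ p) E = 1 := by rw [hE, map_add, map_smul, Theta_hor, Theta_T]; simp
  have hE2 : E.1 = α p • J n (en p) := by simp [hE, T, hor_fst]
  have h0 : Theta (φ p) (w - Theta (φ p) w • E) = 0 := by
    rw [map_sub, map_smul, hE1]; simp
  have h1 : w ∈ tangent φ p ↔ (w - Theta (φ p) w • E) ∈ tangent φ p := by
    constructor
    · exact fun hw => Submodule.sub_mem _ hw (Submodule.smul_mem _ _ hs)
    · intro hw
      have h2 := Submodule.add_mem _ hw (Submodule.smul_mem _ (Theta (φ p) w) hs)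
      rwa [sub_add_cancel] at h2
  rw [h1, ← hor_eq_of_Theta_eq_zero _ h0]
  change (w - Theta (φ p) w • E).1 ∈ horTangent φ p ↔ _
  rw [hen.mem_horTangent_iff hp h, Prod.fst_sub, Prod.smul_fst, hE2, inner_sub_right,
    inner_smul_right, inner_smul_right, inner_J_J, hen.inner_self hp, sub_eq_zero, mul_one,
    mul_comm]

end IsAdapted

/-! ### Derivatives along Σ computed in a chart -/

section DirDeriv

variable {F : Type*} [NormedAddCommGroup F] [NormedSpace ℝ F]

theorem dirDeriv_diff {φ : M → Heis n} {p : M} (h : Function.Injective (diff φ p)) (f : M → F)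
    (v : TangentSpace (𝓡 (2 * n)) p) :
    dirDeriv φ f p (diff φ p v)
      = (mfderiv (𝓡 (2 * n)) 𝓘(ℝ, F) f p : TangentSpace (𝓡 (2 * n)) p →L[ℝ] F) v := by
  have : Nonempty (TangentSpace (𝓡 (2 * n)) p) := ⟨0⟩
  rw [dirDeriv, Function.leftInverse_invFun h v]

theorem dirDeriv_add {φ : M → Heis n} {p : M} (h : Function.Injective (diff φ p)) (f : M → F)
    {v w : Heis n} (hv : v ∈ tangent φ p) (hw : w ∈ tangent φ p) :
    dirDeriv φ f p (v + w) = dirDeriv φ f p v + dirDeriv φ f p w := by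
  obtain ⟨v, rfl⟩ := hv
  obtain ⟨w, rfl⟩ := hw
  rw [← map_add]
  exact (dirDeriv_diff h f (v + w)).trans ((map_add _ v w).trans
    (congrArg₂ (· + ·) (dirDeriv_diff h f v) (dirDeriv_diff h f w)).symm)

theorem dirDeriv_smul {φ : M → Heis n} {p : M} (h : Function.Injective (diff φ p)) (f : M → F)
    (c : ℝ) {v : Heis n} (hv : v ∈ tangent φ p) :
    dirDeriv φ f p (c • v) = c • dirDeriv φ f p v := by
  obtain ⟨v, rfl⟩ := hv
  rw [← map_smul]
  exact (dirDeriv_diff h f (c • v)).trans ((map_smul _ c v).trans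
    (congrArg (c • ·) (dirDeriv_diff h f v)).symm)

theorem mdifferentiable_of_mem_maximalAtlas [IsManifold (𝓡 (2 * n)) 2 M]
    {e : OpenPartialHomeomorph M (EuclideanSpace ℝ (Fin (2 * n)))}
    (he : e ∈ IsManifold.maximalAtlas (𝓡 (2 * n)) 2 M) :
    e.MDifferentiable (𝓡 (2 * n)) (𝓡 (2 * n)) :=
  ⟨(contMDiffOn_of_mem_maximalAtlas he).mdifferentiableOn two_ne_zero,
    (contMDiffOn_symm_of_mem_maximalAtlas he).mdifferentiableOn two_ne_zero⟩

variable {e : OpenPartialHomeomorph M (EuclideanSpace ℝ (Fin (2 * n)))}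
  (he : e.MDifferentiable (𝓡 (2 * n)) (𝓡 (2 * n)))
include he

theorem hasMFDerivAt_of_chart {f : M → F} {x : EuclideanSpace ℝ (Fin (2 * n))}
    (hx : x ∈ e.target) (hf : DifferentiableAt ℝ (f ∘ e.symm) x) :
    HasMFDerivAt (𝓡 (2 * n)) 𝓘(ℝ, F) f (e.symm x)
      ((fderiv ℝ (f ∘ e.symm) x).comp (mfderiv (𝓡 (2 * n)) (𝓡 (2 * n)) e (e.symm x))) := by
  have hs := e.map_target hx
  have h1 : HasMFDerivAt 𝓘(ℝ, EuclideanSpace ℝ (Fin (2 * n))) 𝓘(ℝ, F) (f ∘ e.symm)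
      (e (e.symm x)) (fderiv ℝ (f ∘ e.symm) x) := by
    rw [e.right_inv hx]; exact hf.hasFDerivAt.hasMFDerivAt
  refine (h1.comp (e.symm x) (he.mdifferentiableAt hs).hasMFDerivAt).congr_of_eventuallyEq ?_
  filter_upwards [e.open_source.mem_nhds hs] with q hq
  simp [e.left_inv hq]

theorem differentiableAt_chart_of_mdifferentiableAt {f : M → F}
    {x : EuclideanSpace ℝ (Fin (2 * n))} (hx : x ∈ e.target)
    (hf : MDifferentiableAt (𝓡 (2 * n)) 𝓘(ℝ, F) f (e.symm x)) :
    DifferentiableAt ℝ (f ∘ e.symm) x :=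
  (hf.comp x (he.mdifferentiableAt_symm hx)).differentiableAt

/-- No differentiability is needed: it holds on M exactly when it holds in the chart, and otherwise
both sides take the default value 0. This matters because e_n is differentiated before its
smoothness is known. -/
theorem mfderiv_of_chart (f : M → F) {x : EuclideanSpace ℝ (Fin (2 * n))} (hx : x ∈ e.target)
    (v : TangentSpace (𝓡 (2 * n)) (e.symm x)) :
    (mfderiv (𝓡 (2 * n)) 𝓘(ℝ, F) f (e.symm x) : TangentSpace (𝓡 (2 * n)) (e.symm x) →L[ℝ] F) v
      = fderiv ℝ (f ∘ e.symm) x (mfderiv (𝓡 (2 * n)) (𝓡 (2 * n)) e (e.symm x) v) := by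
  by_cases hf : DifferentiableAt ℝ (f ∘ e.symm) x
  · rw [(hasMFDerivAt_of_chart he hx hf).mfderiv]; rfl
  · rw [mfderiv_zero_of_not_mdifferentiableAt fun h => hf
      (differentiableAt_chart_of_mdifferentiableAt he hx h), fderiv_zero_of_not_differentiableAt hf]
    rfl

theorem mem_tangent_chart_iff {φ : M → Heis n} {x : EuclideanSpace ℝ (Fin (2 * n))}
    (hx : x ∈ e.target) (w : Heis n) :
    w ∈ tangent φ (e.symm x) ↔ ∃ v, fderiv ℝ (φ ∘ e.symm) x v = w := by
  constructor
  · rintro ⟨v, rfl⟩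
    exact ⟨_, (mfderiv_of_chart he φ hx v).symm⟩
  · rintro ⟨v, rfl⟩
    obtain ⟨v', hv'⟩ := he.mfderiv_surjective (e.map_target hx) v
    refine ⟨v', ?_⟩
    subst hv'
    exact mfderiv_of_chart he φ hx v'

theorem dirDeriv_chart {φ : M → Heis n} {x : EuclideanSpace ℝ (Fin (2 * n))}
    (hx : x ∈ e.target) (h : Function.Injective (diff φ (e.symm x))) (f : M → F)
    (v : EuclideanSpace ℝ (Fin (2 * n))) :
    dirDeriv φ f (e.symm x) (fderiv ℝ (φ ∘ e.symm) x v) = fderiv ℝ (f ∘ e.symm) x v := by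
  obtain ⟨v', hv'⟩ := he.mfderiv_surjective (e.map_target hx) v
  subst hv'
  rw [← mfderiv_of_chart he f hx v', ← dirDeriv_diff h f v']
  exact congrArg _ (mfderiv_of_chart he φ hx v').symm

theorem fderiv_chart_injective {φ : M → Heis n} {x : EuclideanSpace ℝ (Fin (2 * n))}
    (hx : x ∈ e.target) (h : Function.Injective (diff φ (e.symm x))) :
    Function.Injective (fderiv ℝ (φ ∘ e.symm) x) := by
  rw [injective_iff_map_eq_zero]
  intro v hv
  obtain ⟨v', hv'⟩ := he.mfderiv_surjective (e.map_target hx) v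
  subst hv'
  have h1 : diff φ (e.symm x) v' = 0 := (mfderiv_of_chart he φ hx v').trans hv
  rw [(injective_iff_map_eq_zero _).1 h v' h1]
  exact map_zero _

end DirDeriv

end Hypersurface

end HeisenbergUmbilic

namespace HeisenbergUmbilic

/-! ### From umbilic hypersurfaces to umbilic patches -/

section Hypersurface

variable {n : ℕ} {M : Type*} [TopologicalSpace M]
  [ChartedSpace (EuclideanSpace ℝ (Fin (2 * n))) M]

/-- A common eigenvalue on a spanning set makes 𝔖 scalar on ξ'. Additivity of 𝔖 needs the span to
consist of tangent directions, because `dirDeriv` inverts `diff φ p` only on its range. The scalar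
is compared with `k` on the given eigenvector. -/
theorem shape_eq_smul {φ : M → Heis n} (hn : 2 ≤ n) {W : Set M} {en : M → Hor n} {α : M → ℝ}
    (hen : IsAdapted φ W en α) {p : M} (hp : p ∈ W) (h : Function.Injective (diff φ p))
    (humb : IsUmbilicAt φ p) {k : ℝ} (hk : IsEigenvalueAt φ en α p k) {a : Hor n}
    (ha : a ∈ xiPrime φ p) : shape φ en α p a = k • a := by
  obtain ⟨-, e, lam, -, hspan, he, hlam⟩ := humb.2 W en α hen hp
  -- The index 0 exists because `n ≥ 2`.
  have key : ∀ b ∈ xiPrime φ p, shape φ en α p b = lam ⟨0, by omega⟩ • b := by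
    intro b hb
    rw [← hspan] at hb
    have hsub : ∀ b ∈ Submodule.span ℝ (Set.range e), hor (φ p) b ∈ tangent φ p := fun b hb => by
      rw [hspan] at hb
      exact hb.1
    induction hb using Submodule.span_induction with
    | mem b hb =>
      obtain ⟨j, rfl⟩ := hb
      rw [he j, hlam j]
    | zero =>
      have h0 : nabla φ (fun q => J n (en q)) p 0 = 0 := by
        rw [nabla, map_zero]
        simpa using dirDeriv_smul h (fun q => J n (en q)) 0 (tangent φ p).zero_mem
      simp [shape, h0, Jprime]
    | add b c hb hc ihb ihc =>
      rw [smul_add, ← ihb, ← ihc]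
      simp only [shape, nabla, Jprime, map_add, map_sub, map_smul, inner_add_right,
        dirDeriv_add h _ (hsub b hb) (hsub c hc)]
      module
    | smul r b hb ihb =>
      rw [smul_comm, ← ihb]
      simp only [shape, nabla, Jprime, map_sub, map_smul, inner_smul_right,
        dirDeriv_smul h _ r (hsub b hb)]
      module
  obtain ⟨b, hb, hb0, hbk⟩ := hk
  have hkl : lam ⟨0, by omega⟩ = k := smul_left_injective ℝ hb0 ((key b hb).symm.trans hbk)
  rw [key a ha, hkl]

theorem fderiv_fst_chart {Φ : EuclideanSpace ℝ (Fin (2 * n)) → Heis n}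
    {x : EuclideanSpace ℝ (Fin (2 * n))} (hΦ : DifferentiableAt ℝ Φ x)
    (v : EuclideanSpace ℝ (Fin (2 * n))) :
    fderiv ℝ (fun y => (Φ y).1) x v = (fderiv ℝ Φ x v).1 := by
  rw [hΦ.hasFDerivAt.fst.fderiv]; rfl

theorem contactPullback_chart {Φ : EuclideanSpace ℝ (Fin (2 * n)) → Heis n}
    {x : EuclideanSpace ℝ (Fin (2 * n))} (hΦ : DifferentiableAt ℝ Φ x)
    (v : EuclideanSpace ℝ (Fin (2 * n))) :
    contactPullback (complexStructure n) (fun y => (Φ y).1) (fun y => (Φ y).2) x v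
      = Theta (Φ x) (fderiv ℝ Φ x v) := by
  rw [Theta_apply, ← fderiv_fst_chart hΦ]
  have h : fderiv ℝ (fun y => (Φ y).2) x v = (fderiv ℝ Φ x v).2 := by
    rw [hΦ.hasFDerivAt.snd.fderiv]; rfl
  rw [← h]
  rfl

/-- In a chart in which it is smooth, an umbilic hypersurface is an umbilic patch. -/
theorem umbilicPatch_of_chart {φ : M → Heis n} (hn : 2 ≤ n) (hφ : IsHypersurface φ)
    (humb : IsUmbilic φ) {W : Set M} {en : M → Hor n} {α k l : M → ℝ}
    (hen : IsAdapted φ W en α) (hk : ∀ p ∈ W, IsEigenvalueAt φ en α p (k p))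
    (hl : ∀ p ∈ W, -nabla φ (fun q => J n (en q)) p (en p) - l p • en p ∈ xiPrime φ p)
    {e : OpenPartialHomeomorph M (EuclideanSpace ℝ (Fin (2 * n)))}
    (he : e.MDifferentiable (𝓡 (2 * n)) (𝓡 (2 * n)))
    (hs : ContDiffOn ℝ ∞ (φ ∘ e.symm) e.target) :
    UmbilicPatch (complexStructure n) (e.target ∩ e.symm ⁻¹' W) (fun y => (φ (e.symm y)).1)
      (fun y => (φ (e.symm y)).2) (fun y => J n (en (e.symm y))) (α ∘ e.symm) (k ∘ e.symm)
      (l ∘ e.symm) := by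
  have hΦ : ∀ x ∈ e.target ∩ e.symm ⁻¹' W, ContDiffAt ℝ ∞ (φ ∘ e.symm) x := fun x hx =>
    hs.contDiffAt (e.open_target.mem_nhds hx.1)
  have hΦd : ∀ x ∈ e.target ∩ e.symm ⁻¹' W, DifferentiableAt ℝ (φ ∘ e.symm) x := fun x hx =>
    (hΦ x hx).differentiableAt (by simp)
  have hZ : ∀ x ∈ e.target ∩ e.symm ⁻¹' W, ∀ v, fderiv ℝ (fun y => (φ (e.symm y)).1) x v
      = (fderiv ℝ (φ ∘ e.symm) x v).1 := fun x hx => fderiv_fst_chart (hΦd x hx)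
  have hθ : ∀ x ∈ e.target ∩ e.symm ⁻¹' W, ∀ v, contactPullback (complexStructure n)
      (fun y => (φ (e.symm y)).1) (fun y => (φ (e.symm y)).2) x v
      = Theta (φ (e.symm x)) (fderiv ℝ (φ ∘ e.symm) x v) := fun x hx =>
    contactPullback_chart (hΦd x hx)
  have hnabla : ∀ x ∈ e.target ∩ e.symm ⁻¹' W, ∀ v,
      Theta (φ (e.symm x)) (fderiv ℝ (φ ∘ e.symm) x v) = 0 →
      nabla φ (fun q => J n (en q)) (e.symm x) (fderiv ℝ (φ ∘ e.symm) x v).1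
        = fderiv ℝ (fun y => J n (en (e.symm y))) x v := by
    intro x hx v hv
    rw [nabla, hor_eq_of_Theta_eq_zero _ hv, dirDeriv_chart he hx.1 (hφ.immersion _)]
    rfl
  have hu : ∀ a : Hor n, -(complexStructure n) (J n a) = a := fun a => by
    rw [complexStructure_apply, J_J, neg_neg]
  refine ⟨e.isOpen_inter_preimage_symm hen.isOpen, fun x hx => (hΦ x hx).fst,
    fun x hx => (hΦ x hx).snd, fun x hx => ?_, fun x hx => ?_, fun x hx v => ?_,
    fun x hx v h1 h2 => ?_, fun x hx a s h1 => ?_, fun x hx v h1 h2 => ?_, fun x hx v h1 h2 => ?_,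
    fun x hx => ?_⟩
  · exact (complexStructure n).continuous.continuousAt.comp
      (ContinuousAt.comp (hen.continuousOn.continuousAt (hen.isOpen.mem_nhds hx.2))
        (e.continuousAt_symm hx.1))
  · rw [norm_eq_sqrt_real_inner, inner_J_J, hen.inner_self hx.2, Real.sqrt_one]
  · rw [hZ x hx, hθ x hx]
    exact (hen.mem_tangent_iff hx.2 (hφ.immersion _) _).1
      ((mem_tangent_chart_iff he hx.1 _).2 ⟨v, rfl⟩)
  · rw [hZ x hx] at h1
    rw [hθ x hx] at h2
    refine fderiv_chart_injective he hx.1 (hφ.immersion _) ?_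
    rw [map_zero]
    exact ext_of_fst_of_Theta (φ (e.symm x)) h1 (by rw [h2, map_zero])
  · have hw : Theta (φ (e.symm x)) (hor (φ (e.symm x)) a + s • T n) = s := by
      rw [map_add, map_smul, Theta_hor, Theta_T]; simp
    have hw1 : (hor (φ (e.symm x)) a + s • T n).1 = a := by simp [hor_fst, T]
    obtain ⟨v, hv⟩ := (mem_tangent_chart_iff he hx.1 _).1
      ((hen.mem_tangent_iff hx.2 (hφ.immersion _) (hor (φ (e.symm x)) a + s • T n)).2 (by
        rw [hw, hw1]; exact h1))
    exact ⟨v, by rw [hZ x hx, hv, hw1], by rw [hθ x hx, hv, hw]⟩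
  · rw [hu, hZ x hx] at h2
    rw [hθ x hx] at h1
    have ht := (hen.mem_tangent_iff hx.2 (hφ.immersion _) _).1
      ((mem_tangent_chart_iff he hx.1 _).2 ⟨v, rfl⟩)
    rw [h1, mul_zero] at ht
    have hsh := shape_eq_smul hn hen hx.2 (hφ.immersion _) (humb _ (hen.regular _ hx.2))
      (hk _ hx.2) ((hen.mem_xiPrime_iff hx.2 (hφ.immersion _) _).2 ⟨ht, h2⟩)
    rw [shape, hnabla x hx v h1, Jprime, h2, zero_smul, sub_zero] at hsh
    rw [hZ x hx, complexStructure_apply, Function.comp_apply, Function.comp_apply, ← hsh]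
    abel
  · rw [hu, hZ x hx] at h2
    rw [hθ x hx] at h1
    rw [hu]
    have h3 := ((hen.mem_xiPrime_iff hx.2 (hφ.immersion _) _).1 (hl _ hx.2)).2
    have h4 := hnabla x hx v h1
    rw [h2] at h4
    rw [h4, inner_sub_right, inner_neg_right, inner_smul_right, hen.inner_self hx.2] at h3
    rw [Function.comp_apply]
    linarith
  -- The eigenvector belonging to `k` is a nonzero element of ξ'.
  · obtain ⟨a, ha, ha0, -⟩ := hk _ hx.2
    rw [hen.mem_xiPrime_iff hx.2 (hφ.immersion _)] at ha
    exact ⟨a, ha0, ha.1, by rw [hu]; exact ha.2⟩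

end Hypersurface

end HeisenbergUmbilic

/-! ### Transferring the patch identities back to M -/

theorem proposition4p2 {n : ℕ} (hn : 2 ≤ n) {M : Type*} [TopologicalSpace M]
    [ChartedSpace (EuclideanSpace ℝ (Fin (2 * n))) M] [IsManifold (𝓡 (2 * n)) 2 M]
    (φ : M → HeisenbergUmbilic.Heis n) (hφ : HeisenbergUmbilic.IsHypersurface φ)
    (humb : HeisenbergUmbilic.IsUmbilic φ)
    (W : Set M) (en : M → HeisenbergUmbilic.Hor n) (α k l : M → ℝ)
    (hen : HeisenbergUmbilic.IsAdapted φ W en α)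
    (hk : ∀ p ∈ W, HeisenbergUmbilic.IsEigenvalueAt φ en α p (k p))
    (hl : ∀ p ∈ W, - HeisenbergUmbilic.nabla φ (fun q => HeisenbergUmbilic.J n (en q)) p (en p)
      - l p • en p ∈ HeisenbergUmbilic.xiPrime φ p) :
    ∀ p ∈ W,
      (MDifferentiableAt (𝓡 (2 * n)) 𝓘(ℝ, ℝ) k p ∧
        MDifferentiableAt (𝓡 (2 * n)) 𝓘(ℝ, ℝ) l p ∧
        MDifferentiableAt (𝓡 (2 * n)) 𝓘(ℝ, ℝ) α p ∧
        MDifferentiableAt (𝓡 (2 * n)) 𝓘(ℝ, ℝ) (HeisenbergUmbilic.derivEn φ en α) p) ∧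
      (∀ e ∈ HeisenbergUmbilic.xiPrime φ p,
        HeisenbergUmbilic.dirDeriv φ k p (HeisenbergUmbilic.hor (φ p) e) = 0 ∧
        HeisenbergUmbilic.dirDeriv φ l p (HeisenbergUmbilic.hor (φ p) e) = 0 ∧
        HeisenbergUmbilic.dirDeriv φ α p (HeisenbergUmbilic.hor (φ p) e) = 0 ∧
        HeisenbergUmbilic.dirDeriv φ (HeisenbergUmbilic.derivEn φ en α) p
          (HeisenbergUmbilic.hor (φ p) e) = 0) ∧
      HeisenbergUmbilic.derivEn φ en k p = (l p - 2 * k p) * α p ∧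
      HeisenbergUmbilic.derivEn φ en α p = k p ^ 2 - α p ^ 2 - k p * l p ∧
      HeisenbergUmbilic.dirDeriv φ k p (HeisenbergUmbilic.hatE φ en α p) =
        α p * (k p ^ 2 + HeisenbergUmbilic.derivEn φ en α p + α p ^ 2)
          / Real.sqrt (1 + α p ^ 2) ∧
      HeisenbergUmbilic.dirDeriv φ α p (HeisenbergUmbilic.hatE φ en α p) =
        - k p * HeisenbergUmbilic.derivEn φ en α p / Real.sqrt (1 + α p ^ 2) ∧
      HeisenbergUmbilic.dirDeriv φ l p (HeisenbergUmbilic.hatE φ en α p) =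
        (HeisenbergUmbilic.derivEn φ en (HeisenbergUmbilic.derivEn φ en α) p
          + 6 * α p * HeisenbergUmbilic.derivEn φ en α p + 4 * α p ^ 3 + α p * l p ^ 2)
          / Real.sqrt (1 + α p ^ 2) := by
  intro p hp
  obtain ⟨e, he, hpe, hs⟩ := hφ.smooth_regular p (hen.regular p hp)
  replace he := HeisenbergUmbilic.mdifferentiable_of_mem_maximalAtlas he
  have P := HeisenbergUmbilic.umbilicPatch_of_chart hn hφ humb hen hk hl he hs
  have hJ := HeisenbergUmbilic.isComplexStructure n
  obtain ⟨x, hxt, rfl⟩ : ∃ x ∈ e.target, e.symm x = p := ⟨e p, e.map_source hpe, e.left_inv hpe⟩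
  have hx : x ∈ e.target ∩ e.symm ⁻¹' W := ⟨hxt, hp⟩
  have hΦd : ∀ y ∈ e.target ∩ e.symm ⁻¹' W, DifferentiableAt ℝ (φ ∘ e.symm) y := fun y hy =>
    (hs.contDiffAt (e.open_target.mem_nhds hy.1)).differentiableAt (by simp)
  have hu : ∀ a : HeisenbergUmbilic.Hor n,
      -(HeisenbergUmbilic.complexStructure n) (HeisenbergUmbilic.J n a) = a := fun a => by
    rw [HeisenbergUmbilic.complexStructure_apply, HeisenbergUmbilic.J_J, neg_neg]
  have hdir : ∀ y ∈ e.target ∩ e.symm ⁻¹' W, ∀ (f : M → ℝ) v,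
      HeisenbergUmbilic.dirDeriv φ f (e.symm y) (fderiv ℝ (φ ∘ e.symm) y v)
        = fderiv ℝ (f ∘ e.symm) y v := fun y hy f v =>
    HeisenbergUmbilic.dirDeriv_chart he hy.1 (hφ.immersion _) f v

  -- A tangent vector of H_n is determined by its horizontal part and its contact form, so the lifts
  -- in the patch are the chart representatives of e_n and αe_{2n} + T.
  have hlift : ∀ y ∈ e.target ∩ e.symm ⁻¹' W, ∀ v (w : HeisenbergUmbilic.Heis n),
      fderiv ℝ (fun z => (φ (e.symm z)).1) y v = w.1 →
      HeisenbergUmbilic.contactPullback (HeisenbergUmbilic.complexStructure n)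
        (fun z => (φ (e.symm z)).1) (fun z => (φ (e.symm z)).2) y v
        = HeisenbergUmbilic.Theta (φ (e.symm y)) w →
      fderiv ℝ (φ ∘ e.symm) y v = w := fun y hy v w h1 h2 =>
    HeisenbergUmbilic.ext_of_fst_of_Theta (φ (e.symm y))
      ((HeisenbergUmbilic.fderiv_fst_chart (hΦd y hy) v).symm.trans h1)
      ((HeisenbergUmbilic.contactPullback_chart (hΦd y hy) v).symm.trans h2)
  have hen' : ∀ y ∈ e.target ∩ e.symm ⁻¹' W, ∀ f : M → ℝ,
      HeisenbergUmbilic.derivEn φ en f (e.symm y) = fderiv ℝ (f ∘ e.symm) y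
        (HeisenbergUmbilic.tangentLift (HeisenbergUmbilic.complexStructure n)
          (fun z => (φ (e.symm z)).1) (fun z => (φ (e.symm z)).2) y
          (-(HeisenbergUmbilic.complexStructure n) (HeisenbergUmbilic.J n (en (e.symm y))), 0)) := by
    intro y hy f
    obtain ⟨h1, h2⟩ := P.lift_charDir_spec hJ hy
    rw [HeisenbergUmbilic.derivEn, ← hdir y hy, hlift y hy _
      (HeisenbergUmbilic.hor (φ (e.symm y)) (en (e.symm y))) (by rw [h1, hu]; rfl)
      (by rw [h2, HeisenbergUmbilic.Theta_hor])]
  -- Equality on a neighbourhood, not only at `x`, since e_nα is differentiated again.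
  have hA : HeisenbergUmbilic.derivEn φ en α ∘ e.symm =ᶠ[nhds x]
      HeisenbergUmbilic.charDeriv (HeisenbergUmbilic.complexStructure n)
        (fun z => (φ (e.symm z)).1) (fun z => (φ (e.symm z)).2)
        (fun z => HeisenbergUmbilic.J n (en (e.symm z))) (α ∘ e.symm) := by
    filter_upwards [P.isOpen.mem_nhds hx] with y hy
    exact hen' y hy α
  have hAx := hA.eq_of_nhds
  have hAd := hA.fderiv_eq (𝕜 := ℝ)
  rw [Function.comp_apply] at hAx
  have hmd : ∀ {f : M → ℝ}, DifferentiableAt ℝ (f ∘ e.symm) x →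
      MDifferentiableAt (𝓡 (2 * n)) 𝓘(ℝ, ℝ) f (e.symm x) := fun hf =>
    (HeisenbergUmbilic.hasMFDerivAt_of_chart he hxt hf).mdifferentiableAt
  have hhat : ∀ f : M → ℝ, HeisenbergUmbilic.dirDeriv φ f (e.symm x)
      (HeisenbergUmbilic.hatE φ en α (e.symm x)) = fderiv ℝ (f ∘ e.symm) x
        (HeisenbergUmbilic.tangentLift (HeisenbergUmbilic.complexStructure n)
          (fun z => (φ (e.symm z)).1) (fun z => (φ (e.symm z)).2) x
          ((α ∘ e.symm) x • HeisenbergUmbilic.J n (en (e.symm x)), 1))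
        / Real.sqrt (1 + α (e.symm x) ^ 2) := by
    intro f
    obtain ⟨h1, h2⟩ := P.lift_transverse_spec hx
    rw [HeisenbergUmbilic.hatE, HeisenbergUmbilic.dirDeriv_smul (hφ.immersion _) f _
      (hen.alpha_spec _ hp), ← hdir x hx, hlift x hx _
      (α (e.symm x) • HeisenbergUmbilic.hor (φ (e.symm x)) (HeisenbergUmbilic.J n (en (e.symm x)))
        + HeisenbergUmbilic.T n) (by rw [h1]; simp [HeisenbergUmbilic.hor_fst, HeisenbergUmbilic.T])
      (by rw [h2, map_add, map_smul, HeisenbergUmbilic.Theta_hor, HeisenbergUmbilic.Theta_T]; simp),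
      smul_eq_mul, div_eq_inv_mul]
  obtain ⟨hkE, hαE⟩ := P.fderiv_k_and_alpha_transverse hJ hx
  refine ⟨⟨hmd ((P.contDiffAt_k hJ hx).differentiableAt (by simp)),
    hmd ((P.contDiffAt_l hJ hx).differentiableAt (by simp)), hmd (P.differentiableAt_alpha hx),
    hmd (((P.contDiffAt_charDeriv hJ hx).differentiableAt (by simp)).congr_of_eventuallyEq hA)⟩,
    fun a ha => ?_, ?_, ?_, ?_, ?_, ?_⟩
  · rw [hen.mem_xiPrime_iff hp (hφ.immersion _)] at ha
    obtain ⟨v, h1, h2⟩ := P.surjective x hx a 0 (by rw [mul_zero]; exact ha.1)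
    have hv := hlift x hx v (HeisenbergUmbilic.hor (φ (e.symm x)) a) h1
      (by rw [h2, HeisenbergUmbilic.Theta_hor])
    have hvc : HeisenbergUmbilic.IsComplexTangent (HeisenbergUmbilic.complexStructure n)
        (fun z => (φ (e.symm z)).1) (fun z => (φ (e.symm z)).2)
        (fun z => HeisenbergUmbilic.J n (en (e.symm z))) x v := by
      refine ⟨h2, by rw [h1]; exact ha.1, ?_⟩
      rw [h1, HeisenbergUmbilic.complexStructure_apply, HeisenbergUmbilic.J_J, inner_neg_left,
        ha.2, neg_zero]
    rw [← hv, hdir x hx, hdir x hx, hdir x hx, hdir x hx, hAd]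
    exact ⟨P.fderiv_k_complex hJ hx hvc, P.fderiv_l_complex hJ hx hvc,
      P.fderiv_alpha_complex hJ hx hvc, P.fderiv_charDeriv_complex_eq_zero hJ hx hvc⟩
  · rw [hen' x hx]
    exact P.fderiv_k_charDir hJ hx
  · rw [hAx]
    exact P.charDeriv_eq hJ hx
  · rw [hhat, hAx, hkE]
    rfl
  · rw [hhat, hAx, hαE]
    rfl
  · rw [hhat, hen' x hx (HeisenbergUmbilic.derivEn φ en α), hAd, hAx,
      P.fderiv_l_transverse hJ hx]
    rfl
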